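/- Let $M$ be a closed (compact, without boundary) smooth manifold with a smooth Riemannian metric, and let $\alpha$ be a free homotopy class (possibly trivial) of loops $S^1=\mathbb{R}/\mathbb{Z}\to M$. A \emph{periodic geodesic} is a map $x\in C^\infty(S^1,M)$ with $\nabla_t\partial_t x\equiv 0$, where $\nabla$ is the Levi-Civita connection; constant loops are allowed. Let the marked length spectrum $$\Lambda_\alpha:=\{\,\mathrm{length}(x)\mid x\in C^\infty(S^1,M),\ \nabla_t\partial_t x\equiv 0,\ [x]=\alpha\,\}\subset\mathbb{R}$$ be the set of lengths of all periodic geodesics representing $\alpha$. Then $\Lambda_\alpha$ is a closed and nowhere dense subset of $\mathbb{R}$. Equivalently, its complement $\mathbb{R}\setminus\Lambda_\alpha$ is open and dense in $\mathbb{R}$. -/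

import Mathlib

open scoped Manifold ContDiff

noncomputable section

namespace MarkedLength

variable {n : ℕ} {M : Type*} [TopologicalSpace M] [ChartedSpace (EuclideanSpace ℝ (Fin n)) M]
  [IsManifold (𝓡 n) ∞ M]

/-- The free homotopy classes of loops in `M`: homotopy classes of continuous maps
`S¹ = ℝ/ℤ → M`, without base points. -/
abbrev FreeHomotopyClass (M : Type*) [TopologicalSpace M] : Type _ :=
  Quotient (⟨ContinuousMap.Homotopic, ContinuousMap.Homotopic.equivalence⟩ :
    Setoid C(UnitAddCircle, M))

/-- The free homotopy class of a loop. -/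
def freeHomotopyClass (x : C(UnitAddCircle, M)) : FreeHomotopyClass M :=
  Quotient.mk _ x

/-- The 1-periodic curve `ℝ → M` given by a loop `ℝ/ℤ → M`. -/
def toCurve (x : C(UnitAddCircle, M)) (t : ℝ) : M := x (t : UnitAddCircle)

/-- A smooth Riemannian metric on the manifold `M`. -/
abbrev RiemannianMetric (n : ℕ) (M : Type*) [TopologicalSpace M]
    [ChartedSpace (EuclideanSpace ℝ (Fin n)) M] [IsManifold (𝓡 n) ∞ M] :=
  Bundle.ContMDiffRiemannianMetric (𝓡 n) ∞ (EuclideanSpace ℝ (Fin n))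
    (fun x : M ↦ TangentSpace (𝓡 n) x)

/-- The metric in the coordinates of the chart at `p`, as a bilinear form `(g_{ij}(y))` on `ℝⁿ`
depending on the coordinate `y`: the pullback of `g` under the inverse of the chart. -/
def chartMetric (g : RiemannianMetric n M) (p : M) (y : EuclideanSpace ℝ (Fin n)) :
    EuclideanSpace ℝ (Fin n) →L[ℝ] EuclideanSpace ℝ (Fin n) →L[ℝ] ℝ :=
  let q : M := (extChartAt (𝓡 n) p).symm y
  let A : EuclideanSpace ℝ (Fin n) →L[ℝ] EuclideanSpace ℝ (Fin n) :=
    mfderiv 𝓘(ℝ, EuclideanSpace ℝ (Fin n)) (𝓡 n) (extChartAt (𝓡 n) p).symm y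
  let B : EuclideanSpace ℝ (Fin n) →L[ℝ] EuclideanSpace ℝ (Fin n) →L[ℝ] ℝ := g.inner q
  B.bilinearComp A A

/-- The Christoffel symbols of the first kind in the chart at `p`: the linear form
`z ↦ (1/2) (∂_v g(w, z) + ∂_w g(v, z) - ∂_z g(v, w))` at the coordinate `y`. -/
def christoffelFirst (g : RiemannianMetric n M) (p : M) (y v w : EuclideanSpace ℝ (Fin n)) :
    EuclideanSpace ℝ (Fin n) →L[ℝ] ℝ :=
  let D := fderiv ℝ (chartMetric g p) y
  (1 / 2 : ℝ) • (D v w + D w v - (D.flip v).flip w)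

/-- The Christoffel symbols of the second kind (those of the Levi-Civita connection) in the chart
at `p`: the vector `Γ(v, w)` with `g(Γ(v, w), z) = christoffelFirst g p y v w z` for all `z`. -/
def christoffel (g : RiemannianMetric n M) (p : M) (y v w : EuclideanSpace ℝ (Fin n)) :
    EuclideanSpace ℝ (Fin n) :=
  (chartMetric g p y).inverse (christoffelFirst g p y v w)

/-- The coordinate expression `u'' + Γ(u)(u', u')`, in the chart at `p`, of the Levi-Civita
covariant derivative `∇_t ∂_t γ` of the velocity of the curve `γ`; it is meant at those times at
which `γ` lies in the domain of the chart. -/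
def covariantAcceleration (g : RiemannianMetric n M) (p : M) (γ : ℝ → M) (t : ℝ) :
    EuclideanSpace ℝ (Fin n) :=
  let u : ℝ → EuclideanSpace ℝ (Fin n) := fun s ↦ extChartAt (𝓡 n) p (γ s)
  deriv (deriv u) t + christoffel g p (u t) (deriv u t) (deriv u t)

/-- `x : S¹ → M` is a periodic geodesic: it is smooth and `∇_t ∂_t x ≡ 0`. Constant loops are
included. -/
def IsPeriodicGeodesic (g : RiemannianMetric n M) (x : C(UnitAddCircle, M)) : Prop :=
  ContMDiff 𝓘(ℝ, ℝ) (𝓡 n) ∞ (toCurve x) ∧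
    ∀ (p : M) (t : ℝ), toCurve x t ∈ (extChartAt (𝓡 n) p).source →
      covariantAcceleration g p (toCurve x) t = 0

/-- The velocity vector of a curve. -/
def velocity (γ : ℝ → M) (t : ℝ) : TangentSpace (𝓡 n) (γ t) :=
  mfderiv 𝓘(ℝ, ℝ) (𝓡 n) γ t (1 : ℝ)

/-- The length `∫₀¹ |ẋ(t)| dt` of a (smooth) loop. -/
def loopLength (g : RiemannianMetric n M) (x : C(UnitAddCircle, M)) : ℝ :=
  ∫ t in (0 : ℝ)..1,
    Real.sqrt (g.inner (toCurve x t) (velocity (toCurve x) t) (velocity (toCurve x) t))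

/-- The marked length spectrum `Λ_α`: the set of lengths of all periodic geodesics which represent
the free homotopy class `α`. -/
def markedLengthSpectrum (g : RiemannianMetric n M) (α : FreeHomotopyClass M) : Set ℝ :=
  {ℓ | ∃ x : C(UnitAddCircle, M),
    IsPeriodicGeodesic g x ∧ freeHomotopyClass x = α ∧ loopLength g x = ℓ}

end MarkedLength

end

/-!
The energy of loops turns periodic geodesics into critical points, and Sard's theorem for a finite
dimensional approximation of the loop space shows that there are few critical values; closedness is
a compactness statement.

*Short geodesics.* In a chart the geodesic equation is `u'' = -Q(u, u')`, where `Q` is quadratic in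
the velocity. Solving it with prescribed end points is a fixed point problem for the acceleration in
the Banach space `C([0, 1], ℝⁿ)`, and the inverse function theorem (`exists_bvp_family`) yields, near
each point of `M`, a family of short geodesic arcs which depends smoothly on the end points and
contains every geodesic arc which stays close to the point and is slow enough (`GeodesicFamily`).
The differential of the energy of such an arc with respect to its end points consists of boundary
terms only (`fderiv_jetEnergy_bvpJet`). Geodesics have constant speed, equal to the length when the
period is one. Together with the compactness of `M` this gives, for each `L`, a number `k` and finitely
many of these families such that each periodic geodesic of length at most `L` consists of `k` arcs of
these families (`exists_uniform_arcs`).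

*Closedness.* Along an ultrafilter, periodic geodesics of bounded length converge pointwise; since
arcs depend continuously on their end points, the limit is a periodic geodesic and the lengths
converge (`exists_tendsto_isPeriodicGeodesic`). A loop made of `k` arcs can be deformed by moving its
vertices, so that the free homotopy class does not change in the limit
(`eventually_freeHomotopyClass_eq`).

*Empty interior.* The energy of closed broken geodesics with `k` vertices is a smooth function of
finitely many real variables (`brokenEnergy`). For the vertices of a periodic geodesic the boundary
terms in the first variation formula cancel, so they form a critical point, and the critical value
is `ℓ² / (2k)` for the length `ℓ` (`exists_fderiv_brokenEnergy_eq_zero`). By Sard's theorem for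
real-valued `C^∞` functions, in the form that the critical values have Hausdorff dimension zero
(`dimH_image_eq_zero_of_fderiv_eq_zero`), the lengths of periodic geodesics contain no interval.
-/

universe u

namespace MarkedLength

open Set Filter Topology Metric

/-! ### Smooth local inverses -/

/-- The inverse function theorem for `C^∞` maps with a local inverse which is `C^∞` on its whole
domain. (`ContDiffAt.to_localInverse` only gives smoothness at a single point, which for order `∞`
does not propagate to a neighbourhood.) -/
theorem exists_openPartialHomeomorph_contDiffOn_symm {E F : Type*} [NormedAddCommGroup E]
    [NormedSpace ℝ E] [CompleteSpace E] [NormedAddCommGroup F] [NormedSpace ℝ F]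
    {f : E → F} {U : Set E} (hU : IsOpen U) (hf : ContDiffOn ℝ ∞ f U) {a : E} (ha : a ∈ U)
    (f' : E ≃L[ℝ] F) (hf' : HasFDerivAt f (f' : E →L[ℝ] F) a) :
    ∃ e : OpenPartialHomeomorph E F, a ∈ e.source ∧ e.source ⊆ U ∧ (∀ x, e x = f x) ∧
      ContDiffOn ℝ ∞ e.symm e.target := by
  have hfa : ContDiffAt ℝ ∞ f a := hf.contDiffAt (hU.mem_nhds ha)
  set e₀ := hfa.toOpenPartialHomeomorph f hf' (by simp) with he₀
  have hcont : ContinuousOn (fderiv ℝ f) U := hf.continuousOn_fderiv_of_isOpen hU (by simp)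
  -- on `W` the differential is invertible, so that the inverse is smooth at every point
  set W : Set E := U ∩ fderiv ℝ f ⁻¹' (range ((↑) : (E ≃L[ℝ] F) → (E →L[ℝ] F))) with hW
  have hWo : IsOpen W := hcont.isOpen_inter_preimage hU ContinuousLinearEquiv.isOpen
  refine ⟨e₀.restrOpen W hWo, ?_, ?_, ?_, ?_⟩
  · refine ⟨hfa.mem_toOpenPartialHomeomorph_source hf' (by simp), ha, f', ?_⟩
    exact hf'.fderiv.symm
  · exact fun x hx ↦ hx.2.1
  · intro x; rfl
  · intro y hy
    have hx : (e₀.restrOpen W hWo).symm y ∈ (e₀.restrOpen W hWo).source :=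
      (e₀.restrOpen W hWo).map_target hy
    obtain ⟨g', hg'⟩ := hx.2.2
    have hfx : ContDiffAt ℝ ∞ f ((e₀.restrOpen W hWo).symm y) :=
      hf.contDiffAt (hU.mem_nhds hx.2.1)
    refine ((e₀.restrOpen W hWo).contDiffAt_symm hy (f₀' := g') ?_ hfx).contDiffWithinAt
    have := (hfx.differentiableAt (by simp)).hasFDerivAt
    rw [← hg'] at this
    exact this

/-! ### Critical values of smooth functions on finite-dimensional spaces -/

open Module (finrank)

/-- In a second countable space, the vanishing of the Hausdorff dimension of the image is a local
property. -/
theorem dimH_image_eq_zero_of_locally {X Y : Type*} [EMetricSpace X] [EMetricSpace Y]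
    [SecondCountableTopology X] {f : X → Y} {s : Set X}
    (h : ∀ x ∈ s, ∃ t ∈ 𝓝[s] x, dimH (f '' t) = 0) : dimH (f '' s) = 0 := by
  choose! t ht ht0 using h
  rcases TopologicalSpace.countable_cover_nhdsWithin ht with ⟨u, hus, huc, huU⟩
  refine le_antisymm ((dimH_mono (image_mono huU)).trans ?_) bot_le
  rw [image_iUnion₂, dimH_bUnion huc]
  simp only [iSup_le_iff]
  exact fun x hx ↦ (ht0 x (hus hx)).le

/-- A bound on the differential near a point which vanishes to order `j` there gives a bound on
the function which vanishes to order `j + 1`. -/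
theorem norm_le_pow_of_norm_fderiv_le_pow {V F : Type*} [NormedAddCommGroup V] [NormedSpace ℝ V]
    [NormedAddCommGroup F] [NormedSpace ℝ F] {h : V → F} {c x : V} {ρ C : ℝ} {j : ℕ}
    (hC : 0 ≤ C) (hd : ∀ y ∈ ball c ρ, DifferentiableAt ℝ h y) (hx : x ∈ ball c ρ)
    (hb : ∀ y ∈ ball c ρ, ‖fderiv ℝ h y‖ ≤ C * ‖y - x‖ ^ j) :
    ∀ y ∈ ball c ρ, ‖h y - h x‖ ≤ C * ‖y - x‖ ^ (j + 1) := by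
  intro y hy
  have hconv : Convex ℝ (ball c ρ ∩ closedBall x ‖y - x‖) :=
    (convex_ball c ρ).inter (convex_closedBall x _)
  have := hconv.norm_image_sub_le_of_norm_fderiv_le (f := h) (C := C * ‖y - x‖ ^ j) (𝕜 := ℝ)
    (fun z hz ↦ hd z hz.1) (fun z hz ↦ (hb z hz.1).trans (by
      have : ‖z - x‖ ≤ ‖y - x‖ := by simpa [dist_eq_norm] using hz.2
      gcongr)) ⟨hx, by simp⟩ ⟨hy, by simp [dist_eq_norm]⟩
  calc _ ≤ _ := this
    _ = _ := by ring

/-- If all derivatives of `f` of orders `1, …, N` vanish along `s`, then `f` is locally Hölder of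
exponent `N + 1` along `s`. -/
theorem exists_holderOnWith_of_flat {V : Type*} [NormedAddCommGroup V] [NormedSpace ℝ V]
    {f : V → ℝ} {U s : Set V} (hU : IsOpen U) (hf : ContDiffOn ℝ ∞ f U)
    (hsU : s ⊆ U) (N : ℕ)
    (hflat : ∀ x ∈ s, ∀ j, 1 ≤ j → j ≤ N → iteratedFDeriv ℝ j f x = 0) :
    ∀ x ∈ s, ∃ C : NNReal, ∃ t ∈ 𝓝[s] x, HolderOnWith C ((N + 1 : ℕ) : NNReal) f t := by
  intro c hc
  have hder : ∀ j : ℕ, ContDiffOn ℝ ∞ (iteratedFDeriv ℝ j f) U := fun j x hx ↦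
    ((hf.contDiffAt (hU.mem_nhds hx)).iteratedFDeriv_right (i := j) (m := ∞)
      (by exact le_rfl)).contDiffWithinAt
  have hcont : ContinuousAt (iteratedFDeriv ℝ (N + 1) f) c :=
    ((hder (N + 1)).continuousOn).continuousAt (hU.mem_nhds (hsU hc))
  set C : ℝ := ‖iteratedFDeriv ℝ (N + 1) f c‖ + 1 with hCdef
  have hCev : ∀ᶠ y in 𝓝 c, ‖iteratedFDeriv ℝ (N + 1) f y‖ < C ∧ y ∈ U :=
    (hcont.norm.eventually (gt_mem_nhds (by simp [hCdef]))).and (hU.mem_nhds (hsU hc))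
  obtain ⟨ρ, hρ, hball⟩ := Metric.eventually_nhds_iff_ball.1 hCev
  have hC0 : 0 ≤ C := by positivity
  -- downward induction on the order of the derivative
  have key : ∀ x ∈ s ∩ ball c ρ, ∀ i ≤ N, ∀ y ∈ ball c ρ,
      ‖iteratedFDeriv ℝ (N + 1 - i) f y‖ ≤ C * ‖y - x‖ ^ i := by
    intro x hx i
    induction i with
    | zero => intro _ y hy; simpa using (hball y hy).1.le
    | succ i ih =>
      intro hi y hy
      have hx0 : iteratedFDeriv ℝ (N + 1 - (i + 1)) f x = 0 :=
        hflat x hx.1 _ (by omega) (by omega)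
      have := norm_le_pow_of_norm_fderiv_le_pow (h := iteratedFDeriv ℝ (N + 1 - (i + 1)) f)
        (j := i) hC0 (fun y hy ↦ ((hder _).contDiffAt
          (hU.mem_nhds (hball y hy).2)).differentiableAt (by simp)) hx.2
        (fun y hy ↦ by
          rw [norm_fderiv_iteratedFDeriv]
          have h2 : N + 1 - (i + 1) + 1 = N + 1 - i := by omega
          rw [h2]
          exact ih (by omega) y hy) y hy
      simpa [hx0] using this
  refine ⟨⟨C, hC0⟩, s ∩ ball c ρ, inter_mem_nhdsWithin _ (ball_mem_nhds _ hρ), ?_⟩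
  intro x hx y hy
  have h1 := norm_le_pow_of_norm_fderiv_le_pow (h := f) (j := N) (x := y) hC0
    (fun z hz ↦ (hf.contDiffAt (hU.mem_nhds (hball z hz).2)).differentiableAt (by simp)) hy.2
    (fun z hz ↦ by
      rw [← norm_iteratedFDeriv_one]
      have h3 := key y hy N le_rfl z hz
      rwa [show N + 1 - N = 1 by omega] at h3) x hx.2
  rw [edist_dist, edist_dist, dist_eq_norm, dist_eq_norm]
  calc ENNReal.ofReal ‖f x - f y‖ ≤ ENNReal.ofReal (C * ‖x - y‖ ^ (N + 1)) :=
        ENNReal.ofReal_le_ofReal h1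
    _ = _ := by
      rw [ENNReal.ofReal_mul hC0, ENNReal.ofReal_pow (norm_nonneg _)]
      congr 1
      · exact ENNReal.ofReal_eq_coe_nnreal hC0
      · rw [← ENNReal.rpow_natCast]; simp

/-- The dimension reduction in the proof of Sard's theorem: near a point at which a function `h`
vanishing on `t` has non-zero differential, `t` lies in a smooth hypersurface, and the statement for
the restriction of `f` to this hypersurface applies. -/
theorem exists_nhdsWithin_dimH_image_eq_zero_of_hypersurface {V : Type*}
    [NormedAddCommGroup V] [NormedSpace ℝ V] [FiniteDimensional ℝ V]
    (ih : ∀ (W : Submodule ℝ V), finrank ℝ W < finrank ℝ V → ∀ (f : W → ℝ) (U s : Set W),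
      IsOpen U → ContDiffOn ℝ ∞ f U → s ⊆ U → (∀ x ∈ s, fderiv ℝ f x = 0) → dimH (f '' s) = 0)
    {f h : V → ℝ} {U t : Set V} (hU : IsOpen U) (hf : ContDiffOn ℝ ∞ f U)
    (hh : ContDiffOn ℝ ∞ h U) (hft : ∀ x ∈ t, fderiv ℝ f x = 0)
    (hht : ∀ x ∈ t, h x = 0) {a : V} (ha : a ∈ U) (hda : fderiv ℝ h a ≠ 0) :
    ∃ t' ∈ 𝓝[t] a, dimH (f '' t') = 0 := by
  set ℓ : V →L[ℝ] ℝ := fderiv ℝ h a with hℓ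
  obtain ⟨v, hv⟩ : ∃ v, ℓ v = 1 := by
    obtain ⟨v, hv⟩ : ∃ v, ℓ v ≠ 0 := by
      by_contra! H
      exact hda (ContinuousLinearMap.ext H)
    exact ⟨(ℓ v)⁻¹ • v, by simp [hv]⟩
  set W : Submodule ℝ V := LinearMap.ker (ℓ : V →ₗ[ℝ] ℝ) with hW
  have hWlt : finrank ℝ W < finrank ℝ V := by
    apply Submodule.finrank_lt
    intro htop
    have : v ∈ W := htop ▸ Submodule.mem_top
    simp [hW, hv] at this
  let π : V →L[ℝ] W := (ContinuousLinearMap.id ℝ V - ℓ.smulRight v).codRestrict W (fun x ↦ by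
    simp [hW, hv])
  have hπ : ∀ x, (π x : V) = x - ℓ x • v := fun x ↦ rfl
  let Linv : ℝ × W →L[ℝ] V := (ContinuousLinearMap.fst ℝ ℝ W).smulRight v +
    W.subtypeL.comp (ContinuousLinearMap.snd ℝ ℝ W)
  let e' : V ≃L[ℝ] ℝ × W := ContinuousLinearEquiv.equivOfInverse (ℓ.prod π) Linv
    (fun x ↦ by simp [Linv, hπ]) (fun y ↦ by
      have hy : ℓ (y.2 : V) = 0 := y.2.2
      ext
      · simp [Linv, hv, hy]
      · simp [Linv, hπ, hv, hy])
  -- `h` and the projection `π` to the kernel of its differential are coordinates near `a`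
  let Ψ : V → ℝ × W := fun x ↦ (h x, π x)
  have hΨ : ContDiffOn ℝ ∞ Ψ U := hh.prodMk π.contDiff.contDiffOn
  have hΨ' : HasFDerivAt Ψ (e' : V →L[ℝ] ℝ × W) a :=
    ((hh.contDiffAt (hU.mem_nhds ha)).differentiableAt (by simp)).hasFDerivAt.prodMk
      π.hasFDerivAt
  obtain ⟨e, hae, heU, heq, hsymm⟩ :=
    exists_openPartialHomeomorph_contDiffOn_symm hU hΨ ha e' hΨ'
  let ι : W → ℝ × W := fun w ↦ (0, w)
  have hι : ContDiff ℝ ∞ ι := contDiff_const.prodMk contDiff_id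
  have hU' : IsOpen (ι ⁻¹' e.target) := e.open_target.preimage hι.continuous
  have hφ : ContDiffOn ℝ ∞ (fun w ↦ e.symm (ι w)) (ι ⁻¹' e.target) :=
    hsymm.comp hι.contDiffOn (fun w hw ↦ hw)
  have hmaps : ∀ w ∈ ι ⁻¹' e.target, e.symm (ι w) ∈ U := fun w hw ↦ heU (e.map_target hw)
  have hcomp : ContDiffOn ℝ ∞ (fun w ↦ f (e.symm (ι w))) (ι ⁻¹' e.target) :=
    hf.comp hφ hmaps
  have h0 := ih W hWlt (fun w ↦ f (e.symm (ι w))) (ι ⁻¹' e.target)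
    {w | w ∈ ι ⁻¹' e.target ∧ e.symm (ι w) ∈ t} hU' hcomp (fun w hw ↦ hw.1) (by
      intro w hw
      have h1 : DifferentiableAt ℝ f (e.symm (ι w)) :=
        (hf.contDiffAt (hU.mem_nhds (hmaps w hw.1))).differentiableAt (by simp)
      have h2 : DifferentiableAt ℝ (fun w ↦ e.symm (ι w)) w :=
        (hφ.contDiffAt (hU'.mem_nhds hw.1)).differentiableAt (by simp)
      have h3 := (h1.hasFDerivAt.comp w h2.hasFDerivAt).fderiv
      rw [hft _ hw.2, ContinuousLinearMap.zero_comp] at h3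
      exact h3)
  refine ⟨t ∩ e.source, inter_mem_nhdsWithin _ (e.open_source.mem_nhds hae), ?_⟩
  refine le_antisymm ((dimH_mono ?_).trans h0.le) bot_le
  rintro _ ⟨x, ⟨hxt, hxe⟩, rfl⟩
  have hx : e x = ι (π x) := by rw [heq]; simp [Ψ, ι, hht x hxt]
  have hx2 : e.symm (ι (π x)) = x := by rw [← hx, e.left_inv hxe]
  refine ⟨π x, ⟨?_, ?_⟩, ?_⟩
  · change ι (π x) ∈ e.target
    rw [← hx]; exact e.map_source hxe
  · rw [hx2]; exact hxt
  · simp only [hx2]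

/-- **Sard's theorem** for real-valued `C^∞` functions on a finite-dimensional space: the set of
critical values has Hausdorff dimension zero. -/
theorem dimH_image_eq_zero_of_fderiv_eq_zero {V : Type*}
    [NormedAddCommGroup V] [NormedSpace ℝ V] [FiniteDimensional ℝ V]
    {f : V → ℝ} {U s : Set V} (hU : IsOpen U) (hf : ContDiffOn ℝ ∞ f U) (hsU : s ⊆ U)
    (hs : ∀ x ∈ s, fderiv ℝ f x = 0) : dimH (f '' s) = 0 := by
  induction hd : finrank ℝ V using Nat.strong_induction_on generalizing V with
  | _ d ih =>
  subst hd
  -- the points at which `k + 1` is the least order of a non-vanishing derivative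
  let T : ℕ → Set V := fun k ↦
    {x ∈ s | (∀ j, 1 ≤ j → j ≤ k → iteratedFDeriv ℝ j f x = 0) ∧ iteratedFDeriv ℝ (k + 1) f x ≠ 0}
  have hT : ∀ k, dimH (f '' T k) = 0 := by
    intro k
    rcases Nat.eq_zero_or_pos k with rfl | hk
    · have : T 0 = ∅ := by
        refine eq_empty_of_forall_notMem fun x hx ↦ hx.2.2 ?_
        rw [← norm_eq_zero, zero_add, norm_iteratedFDeriv_one, hs x hx.1, norm_zero]
      simp [this]
    refine dimH_image_eq_zero_of_locally fun a ha ↦ ?_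
    have hder : ContDiffOn ℝ ∞ (iteratedFDeriv ℝ k f) U := fun x hx ↦
      ((hf.contDiffAt (hU.mem_nhds hx)).iteratedFDeriv_right (i := k) (m := ∞)
        (by exact le_rfl)).contDiffWithinAt
    obtain ⟨v, m, hvm⟩ : ∃ v m, fderiv ℝ (iteratedFDeriv ℝ k f) a v m ≠ 0 := by
      by_contra! H
      exact ha.2.2 (by ext m; rw [iteratedFDeriv_succ_apply_left]; exact H _ _)
    let ev := ContinuousMultilinearMap.apply ℝ (fun _ : Fin k ↦ V) ℝ m
    refine exists_nhdsWithin_dimH_image_eq_zero_of_hypersurface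
      (fun W hW f U s h1 h2 h3 h4 ↦ ih _ hW h1 h2 h3 h4 rfl)
      (h := fun x ↦ ev (iteratedFDeriv ℝ k f x)) hU hf (ev.contDiff.comp_contDiffOn hder)
      (fun x hx ↦ hs x hx.1) (fun x hx ↦ ?_) (hsU ha.1) ?_
    · simp [hx.2.1 k hk le_rfl]
    · intro h0
      have h1 := (ev.hasFDerivAt.comp a ((hder.contDiffAt
        (hU.mem_nhds (hsU ha.1))).differentiableAt (by simp)).hasFDerivAt).fderiv
      apply hvm
      have h2 := congrArg (fun φ ↦ φ v) (h0.symm.trans h1)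
      exact h2.symm
  -- where the first `N` derivatives vanish, `f` is Hölder of exponent `N + 1`, and the dimension of
  -- the image is at most `finrank ℝ V / (N + 1)`, which is arbitrarily small
  by_contra hne
  obtain ⟨N, hN⟩ := ENNReal.exists_nat_mul_gt hne (b := finrank ℝ V) (by simp)
  let S : Set V := {x ∈ s | ∀ j, 1 ≤ j → j ≤ N → iteratedFDeriv ℝ j f x = 0}
  have hS : dimH (f '' S) ≤ finrank ℝ V / ((N + 1 : ℕ) : NNReal) := by
    refine (dimH_image_le_of_locally_holder_on (by positivity)
      (exists_holderOnWith_of_flat hU hf (fun x hx ↦ hsU hx.1) N (fun x hx ↦ hx.2))).trans ?_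
    gcongr
    exact (dimH_mono (subset_univ S)).trans (Real.dimH_univ_eq_finrank V).le
  have hcover : s ⊆ S ∪ ⋃ k, T k := by
    intro x hx
    by_cases H : ∀ j, 1 ≤ j → j ≤ N → iteratedFDeriv ℝ j f x = 0
    · exact Or.inl ⟨hx, H⟩
    · right
      classical
      have H' : ∃ k, iteratedFDeriv ℝ (k + 1) f x ≠ 0 := by
        push Not at H
        obtain ⟨j, hj, -, h⟩ := H
        exact ⟨j - 1, by rwa [Nat.sub_add_cancel hj]⟩
      refine mem_iUnion.2 ⟨Nat.find H', hx, fun j hj hjk ↦ ?_, Nat.find_spec H'⟩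
      have := Nat.find_min H' (m := j - 1) (by omega)
      rw [Nat.sub_add_cancel hj] at this
      exact not_not.1 this
  have hle : dimH (f '' s) ≤ finrank ℝ V / ((N + 1 : ℕ) : NNReal) := by
    refine (dimH_mono (image_mono hcover)).trans ?_
    rw [image_union, image_iUnion, dimH_union, dimH_iUnion]
    simpa [hT] using hS
  have h1 : dimH (f '' s) * (N + 1 : ℕ) ≤ finrank ℝ V := by
    refine (ENNReal.le_div_iff_mul_le ?_ ?_).1 (by simpa using hle) <;> simp
  refine absurd hN (not_lt.2 (le_trans ?_ h1))
  rw [mul_comm]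
  gcongr
  exact Nat.le_succ N

/-! ### Superposition operators on spaces of continuous maps -/

section Superposition

variable {K : Type*} [TopologicalSpace K] [CompactSpace K]

/-- The superposition operator `u ↦ f ∘ u` on continuous maps from a compact space. -/
def superpose {E F : Type*} [TopologicalSpace E] [TopologicalSpace F] (f : C(E, F)) (u : C(K, E)) :
    C(K, F) := f.comp u

/-- Pointwise application of a continuous family of linear maps, as a continuous bilinear map. -/
noncomputable def pointwiseApply (K : Type*) [TopologicalSpace K] [CompactSpace K] (E F : Type*)
    [NormedAddCommGroup E] [NormedSpace ℝ E] [NormedAddCommGroup F] [NormedSpace ℝ F] :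
    C(K, E →L[ℝ] F) →L[ℝ] C(K, E) →L[ℝ] C(K, F) :=
  LinearMap.mkContinuous₂
    (LinearMap.mk₂ ℝ (fun (A : C(K, E →L[ℝ] F)) (u : C(K, E)) ↦
        (⟨fun t ↦ A t (u t), by fun_prop⟩ : C(K, F)))
      (fun A B u ↦ by ext; simp) (fun c A u ↦ by ext; simp)
      (fun A u v ↦ by ext; simp) (fun c A u ↦ by ext; simp)) 1
    (fun A u ↦ by
      rw [ContinuousMap.norm_le _ (by positivity)]
      intro t
      simp only [LinearMap.mk₂_apply, ContinuousMap.coe_mk, one_mul]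
      exact ((A t).le_opNorm _).trans (by gcongr <;> exact ContinuousMap.norm_coe_le_norm _ _))

theorem pointwiseApply_apply {E F : Type*}
    [NormedAddCommGroup E] [NormedSpace ℝ E] [NormedAddCommGroup F] [NormedSpace ℝ F]
    (A : C(K, E →L[ℝ] F)) (u : C(K, E)) (t : K) : pointwiseApply K E F A u t = A t (u t) := rfl

theorem hasFDerivAt_superpose {E F : Type*}
    [NormedAddCommGroup E] [NormedSpace ℝ E] [NormedAddCommGroup F] [NormedSpace ℝ F]
    (f : C(E, F)) (f' : C(E, E →L[ℝ] F)) (hf : ∀ x, HasFDerivAt f (f' x) x) (u : C(K, E)) :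
    HasFDerivAt (superpose (K := K) f) (pointwiseApply K E F (superpose f' u)) u := by
  rw [hasFDerivAt_iff_isLittleO_nhds_zero, Asymptotics.isLittleO_iff]
  intro ε hε
  have hcont : Continuous (superpose (K := K) f') := ContinuousMap.continuous_postcomp f'
  obtain ⟨δ, hδ, hball⟩ := (@Metric.continuousAt_iff C(K, E) C(K, E →L[ℝ] F) _ _
    (superpose f') u).1 hcont.continuousAt ε hε
  filter_upwards [ball_mem_nhds (0 : C(K, E)) hδ] with h hh
  rw [ContinuousMap.norm_le _ (by positivity)]
  intro t
  have hh' : ‖h‖ < δ := by simpa using hh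
  have hmv := (convex_ball (u t) δ).norm_image_sub_le_of_norm_hasFDerivWithin_le' (f := f)
    (f' := fun x ↦ f' x) (φ := f' (u t)) (C := ε) (x := u t) (y := u t + h t)
    (fun x _ ↦ (hf x).hasFDerivWithinAt) (fun x hx ↦ by
      -- test the continuity of `u ↦ f' ∘ u` on translates of `u` by constants
      have h1 : dist (u + ContinuousMap.const K (x - u t)) u < δ := by
        rw [dist_eq_norm, add_sub_cancel_left, ContinuousMap.norm_lt_iff _ hδ]
        intro _
        simpa [dist_eq_norm] using hx
      have h2 : dist (superpose f' (u + ContinuousMap.const K (x - u t)) t) (superpose f' u t) ≤ ε :=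
        (ContinuousMap.dist_apply_le_dist t).trans (hball h1).le
      rw [dist_eq_norm] at h2
      simpa [superpose] using h2)
    (mem_ball_self hδ) (by
      simpa using lt_of_le_of_lt (h.norm_coe_le_norm t) hh')
  rw [add_sub_cancel_left] at hmv
  exact hmv.trans (by gcongr; exact h.norm_coe_le_norm t)

/-- Superposition with a `C^∞` map is `C^∞`. The common universe of `E` and `F` is needed in the
induction, which passes from `F` to `E →L[ℝ] F`. -/
theorem contDiff_superpose {E F : Type u} [NormedAddCommGroup E] [NormedSpace ℝ E]
    [NormedAddCommGroup F] [NormedSpace ℝ F] (f : C(E, F)) (hf : ContDiff ℝ ∞ f) :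
    ContDiff ℝ ∞ (superpose (K := K) f) := by
  rw [contDiff_infty]
  intro n
  induction n generalizing F with
  | zero => exact contDiff_zero.2 (ContinuousMap.continuous_postcomp f)
  | succ n ih =>
    have hf' : ContDiff ℝ ∞ (fderiv ℝ f) := hf.fderiv_right (by exact le_rfl)
    let f' : C(E, E →L[ℝ] F) := ⟨fderiv ℝ f, hf'.continuous⟩
    push_cast
    rw [contDiff_succ_iff_hasFDerivAt]
    refine ⟨fun u ↦ pointwiseApply K E F (superpose f' u), ?_, fun u ↦ ?_⟩
    · exact (pointwiseApply K E F).contDiff.comp (ih f' hf')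
    · exact hasFDerivAt_superpose f f' (fun x ↦ (hf.differentiable (by simp) x).hasFDerivAt) u

end Superposition

/-! ### Primitives and curves on the unit interval with given end points -/

section Interval

/-- The extension of a continuous map on `[0, 1]` to the real line by constants. -/
noncomputable def extend {E : Type*} [TopologicalSpace E] (w : C(unitInterval, E)) (t : ℝ) : E :=
  w (projIcc 0 1 zero_le_one t)

theorem continuous_extend {E : Type*} [TopologicalSpace E] (w : C(unitInterval, E)) :
    Continuous (extend w) :=
  w.continuous.comp continuous_projIcc

theorem extend_coe {E : Type*} [TopologicalSpace E] (w : C(unitInterval, E)) (t : unitInterval) :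
    extend w t = w t := by
  simp [extend]

theorem extend_of_mem {E : Type*} [TopologicalSpace E] (w : C(unitInterval, E)) {t : ℝ}
    (ht : t ∈ Icc (0 : ℝ) 1) : extend w t = w ⟨t, ht⟩ := by
  simp [extend, projIcc_of_mem, ht]

variable {E : Type*} [NormedAddCommGroup E] [NormedSpace ℝ E]

/-- The primitive `t ↦ ∫₀ᵗ w` which vanishes at `0`, as an operator on `C([0, 1], E)`. -/
noncomputable def primitive (E : Type*) [NormedAddCommGroup E] [NormedSpace ℝ E] :
    C(unitInterval, E) →L[ℝ] C(unitInterval, E) :=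
  LinearMap.mkContinuous
    { toFun := fun w ↦ ⟨fun t ↦ ∫ s in (0 : ℝ)..t, extend w s, by
        have : Continuous fun t : ℝ ↦ ∫ s in (0 : ℝ)..t, extend w s :=
          intervalIntegral.continuous_primitive
            (fun a b ↦ (continuous_extend w).intervalIntegrable a b) 0
        exact this.comp continuous_subtype_val⟩
      map_add' := fun w₁ w₂ ↦ by
        ext t
        exact intervalIntegral.integral_add ((continuous_extend w₁).intervalIntegrable _ _)
          ((continuous_extend w₂).intervalIntegrable _ _)
      map_smul' := fun c w ↦ by
        ext t
        exact intervalIntegral.integral_smul c (extend w) } 1 (fun w ↦ by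
    rw [ContinuousMap.norm_le _ (by positivity)]
    intro t
    refine (intervalIntegral.norm_integral_le_of_norm_le_const
      (C := ‖w‖) (fun s _ ↦ w.norm_coe_le_norm _)).trans ?_
    rw [sub_zero, abs_of_nonneg t.2.1, one_mul]
    exact mul_le_of_le_one_right (norm_nonneg _) t.2.2)

theorem primitive_apply (w : C(unitInterval, E)) (t : unitInterval) :
    primitive E w t = ∫ s in (0 : ℝ)..t, extend w s := rfl

/-- Constant maps, as a continuous linear map `E → C([0, 1], E)`. -/
noncomputable def constL (E : Type*) [NormedAddCommGroup E] [NormedSpace ℝ E] :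
    E →L[ℝ] C(unitInterval, E) :=
  LinearMap.mkContinuous
    { toFun := fun a ↦ ContinuousMap.const _ a
      map_add' := fun _ _ ↦ rfl
      map_smul' := fun _ _ ↦ rfl } 1 (fun a ↦ by
    rw [ContinuousMap.norm_le _ (by positivity)]; intro t; exact (one_mul _).ge)

@[simp] theorem constL_apply (a : E) (t : unitInterval) : constL E a t = a := rfl

/-- The velocity of the curve on `[0, 1]` with end points `a`, `b` and acceleration `w`, as a
continuous linear function of `((a, b), w)`. -/
noncomputable def bvpVelocity (E : Type*) [NormedAddCommGroup E] [NormedSpace ℝ E] :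
    (E × E) × C(unitInterval, E) →L[ℝ] C(unitInterval, E) :=
  (constL E).comp ((ContinuousLinearMap.snd ℝ E E - ContinuousLinearMap.fst ℝ E E).comp
    (ContinuousLinearMap.fst ℝ _ _)) +
  (primitive E - (constL E).comp ((ContinuousMap.evalCLM ℝ (1 : unitInterval)).comp
    ((primitive E).comp (primitive E)))).comp (ContinuousLinearMap.snd ℝ _ _)

/-- The curve on `[0, 1]` with end points `a`, `b` and acceleration `w`, as a continuous linear
function of `((a, b), w)`. -/
noncomputable def bvpCurve (E : Type*) [NormedAddCommGroup E] [NormedSpace ℝ E] :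
    (E × E) × C(unitInterval, E) →L[ℝ] C(unitInterval, E) :=
  (constL E).comp ((ContinuousLinearMap.fst ℝ E E).comp (ContinuousLinearMap.fst ℝ _ _)) +
    (primitive E).comp (bvpVelocity E)

theorem bvpVelocity_apply (q : (E × E) × C(unitInterval, E)) (t : unitInterval) :
    bvpVelocity E q t = q.1.2 - q.1.1 + (primitive E q.2 t - primitive E (primitive E q.2) 1) := rfl

theorem bvpCurve_apply (q : (E × E) × C(unitInterval, E)) (t : unitInterval) :
    bvpCurve E q t = q.1.1 + primitive E (bvpVelocity E q) t := rfl

theorem bvpCurve_zero (q : (E × E) × C(unitInterval, E)) : bvpCurve E q 0 = q.1.1 := by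
  simp [bvpCurve_apply, primitive_apply]

variable [CompleteSpace E]

theorem bvpCurve_one (q : (E × E) × C(unitInterval, E)) : bvpCurve E q 1 = q.1.2 := by
  have hone : ∀ a : E, primitive E (constL E a) 1 = a := fun a ↦ by
    simp [primitive_apply, extend]
  have hv : bvpVelocity E q = constL E (q.1.2 - q.1.1) +
      (primitive E q.2 - constL E (primitive E (primitive E q.2) 1)) := by
    ext t; simp [bvpVelocity_apply]
  rw [bvpCurve_apply, hv]
  simp [hone]

/-- On `(0, 1)` the primitive of `w`, as a function on the line, has derivative `w`. -/
theorem hasDerivAt_extend_primitive (w : C(unitInterval, E)) {t : ℝ} (ht : t ∈ Ioo (0 : ℝ) 1) :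
    HasDerivAt (extend (primitive E w)) (extend w t) t := by
  have h1 : HasDerivAt (fun t : ℝ ↦ ∫ s in (0 : ℝ)..t, extend w s) (extend w t) t :=
    intervalIntegral.integral_hasDerivAt_right ((continuous_extend w).intervalIntegrable _ _)
      ((continuous_extend w).stronglyMeasurableAtFilter _ _) (continuous_extend w).continuousAt
  refine h1.congr_of_eventuallyEq ?_
  filter_upwards [Ioo_mem_nhds ht.1 ht.2] with s hs
  rw [extend_of_mem _ ⟨hs.1.le, hs.2.le⟩, primitive_apply]

theorem hasDerivAt_extend_bvpVelocity (q : (E × E) × C(unitInterval, E)) {t : ℝ}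
    (ht : t ∈ Ioo (0 : ℝ) 1) : HasDerivAt (extend (bvpVelocity E q)) (extend q.2 t) t := by
  have h := ((hasDerivAt_extend_primitive q.2 ht).sub_const
    (primitive E (primitive E q.2) 1)).const_add (q.1.2 - q.1.1)
  exact h

theorem hasDerivAt_extend_bvpCurve (q : (E × E) × C(unitInterval, E)) {t : ℝ}
    (ht : t ∈ Ioo (0 : ℝ) 1) : HasDerivAt (extend (bvpCurve E q)) (extend (bvpVelocity E q) t) t :=
  (hasDerivAt_extend_primitive _ ht).const_add q.1.1

/-- A twice differentiable curve is determined by its end points and its acceleration. -/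
theorem bvpCurve_eq_of_hasDerivAt {u u' u'' : ℝ → E}
    (hu : ∀ t ∈ Icc (0 : ℝ) 1, HasDerivAt u (u' t) t)
    (hu' : ∀ t ∈ Icc (0 : ℝ) 1, HasDerivAt u' (u'' t) t) (w : C(unitInterval, E))
    (hw : ∀ t : unitInterval, w t = u'' t) :
    (∀ t : unitInterval, bvpVelocity E ((u 0, u 1), w) t = u' t) ∧
      ∀ t : unitInterval, bvpCurve E ((u 0, u 1), w) t = u t := by
  have key : ∀ (f f' : ℝ → E) (w : C(unitInterval, E)),
      (∀ t ∈ Icc (0 : ℝ) 1, HasDerivAt f (f' t) t) → (∀ t : unitInterval, w t = f' t) →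
      ∀ t : unitInterval, primitive E w t = f t - f 0 := by
    intro f f' w hf hw t
    have hsub : uIcc (0 : ℝ) t ⊆ Icc 0 1 := by
      rw [uIcc_of_le t.2.1]; exact Icc_subset_Icc_right t.2.2
    rw [primitive_apply]
    refine intervalIntegral.integral_eq_sub_of_hasDerivAt (fun s hs ↦ ?_)
      ((continuous_extend w).intervalIntegrable _ _)
    rw [extend_of_mem _ (hsub hs), hw]
    exact hf s (hsub hs)
  have h1 := key u' u'' w hu' hw
  have h0 : primitive E (constL E (u' 0)) 1 = u' 0 := by simp [primitive_apply, extend]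
  have h2 := key u u' (primitive E w + constL E (u' 0)) hu (fun t ↦ by simp [h1 t])
  have h3 : primitive E (primitive E w) 1 = u 1 - u 0 - u' 0 := by
    have := h2 1
    rw [map_add, ContinuousMap.add_apply, h0] at this
    rw [eq_sub_iff_add_eq]; simpa using this
  have hv : ∀ t : unitInterval, bvpVelocity E ((u 0, u 1), w) t = u' t := by
    intro t
    rw [bvpVelocity_apply, h1, h3]
    simp only; abel
  refine ⟨hv, fun t ↦ ?_⟩
  rw [bvpCurve_apply, key u u' _ hu hv]
  simp

end Interval

/-! ### Short solutions of second order equations with given end points -/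

section BVP

variable {E : Type u} [NormedAddCommGroup E] [NormedSpace ℝ E]

/-- Position and velocity of the curve on `[0, 1]` with end points `a`, `b` and acceleration `w`. -/
noncomputable def bvpJet (E : Type u) [NormedAddCommGroup E] [NormedSpace ℝ E] :
    (E × E) × C(unitInterval, E) →L[ℝ] C(unitInterval, E × E) :=
  ((ContinuousLinearMap.inl ℝ E E).compLeftContinuous ℝ unitInterval).comp (bvpCurve E) +
    ((ContinuousLinearMap.inr ℝ E E).compLeftContinuous ℝ unitInterval).comp (bvpVelocity E)

theorem bvpJet_apply (q : (E × E) × C(unitInterval, E)) (t : unitInterval) :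
    bvpJet E q t = (bvpCurve E q t, bvpVelocity E q t) := by
  simp [bvpJet, ContinuousLinearMap.compLeftContinuous]

variable [CompleteSpace E]

/-- Let `Q` and its differential vanish at `(y₀, 0)`. Then the solutions of `u'' = -Q(u, u')` on
`[0, 1]` which stay close to `y₀` and have small velocity form a smooth family parametrized by
their end points: `ψ (a, b)` is the acceleration of the solution from `a` to `b`.

The family is the inverse of `((a, b), w) ↦ ((a, b), w + Q(u, u'))`, where `u` is the curve with end
points `a`, `b` and acceleration `w`, restricted to the second component `0`. -/
theorem exists_bvp_family (Q : C(E × E, E)) (hQ : ContDiff ℝ ∞ Q) (y₀ : E) (h0 : Q (y₀, 0) = 0)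
    (h1 : fderiv ℝ Q (y₀, 0) = 0) {O : Set (E × E)} (hO : O ∈ 𝓝 (y₀, (0 : E))) :
    ∃ (ρ r : ℝ) (ψ : E × E → C(unitInterval, E)), 0 < r ∧ r < ρ ∧
      ContDiffOn ℝ ∞ ψ (ball y₀ ρ ×ˢ ball y₀ ρ) ∧
      (∀ q ∈ ball y₀ ρ ×ˢ ball y₀ ρ, ∀ t, bvpJet E (q, ψ q) t ∈ O ∧
        ψ q t = -Q (bvpJet E (q, ψ q) t)) ∧
      ∀ u u' : ℝ → E, (∀ t ∈ Icc (0 : ℝ) 1, u t ∈ ball y₀ r ∧ u' t ∈ ball 0 r ∧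
        HasDerivAt u (u' t) t ∧ HasDerivAt u' (-Q (u t, u' t)) t) →
        ∀ t : unitInterval, bvpJet E ((u 0, u 1), ψ (u 0, u 1)) t = (u t, u' t) := by
  let Φ : (E × E) × C(unitInterval, E) → (E × E) × C(unitInterval, E) :=
    fun q ↦ (q.1, q.2 + superpose Q (bvpJet E q))
  have hΦ : ContDiff ℝ ∞ Φ := contDiff_fst.prodMk
    (contDiff_snd.add ((contDiff_superpose Q hQ).comp (bvpJet E).contDiff))
  set q₀ : (E × E) × C(unitInterval, E) := ((y₀, y₀), 0) with hq₀
  have hjet0 : ∀ t, bvpJet E q₀ t = (y₀, 0) := by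
    intro t
    have hv : bvpVelocity E q₀ = 0 := by
      ext s; simp [bvpVelocity_apply, hq₀]
    rw [bvpJet_apply, bvpCurve_apply, hv]
    simp [hq₀]
  let Q' : C(E × E, E × E →L[ℝ] E) := ⟨fderiv ℝ Q, hQ.continuous_fderiv (by simp)⟩
  -- as `Q` vanishes to second order, the differential of `Φ` is the identity
  have hΦ' : HasFDerivAt Φ ((ContinuousLinearEquiv.refl ℝ ((E × E) × C(unitInterval, E)) :
      (E × E) × C(unitInterval, E) →L[ℝ] (E × E) × C(unitInterval, E))) q₀ := by
    have hs := (hasFDerivAt_superpose Q Q'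
      (fun x ↦ (hQ.differentiable (by simp) x).hasFDerivAt) (bvpJet E q₀)).comp q₀
      (bvpJet E).hasFDerivAt
    have hz : superpose Q' (bvpJet E q₀) = 0 := by
      ext1 t
      change fderiv ℝ Q (bvpJet E q₀ t) = 0
      rw [hjet0, h1]
    rw [hz, map_zero, ContinuousLinearMap.zero_comp] at hs
    have h := (hasFDerivAt_fst (𝕜 := ℝ) (p := q₀)).prodMk
      ((hasFDerivAt_snd (𝕜 := ℝ) (p := q₀)).add hs)
    refine HasFDerivAt.congr_fderiv (f := Φ) h ?_
    ext x <;> simp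
  obtain ⟨e, hae, -, heq, hsymm⟩ := exists_openPartialHomeomorph_contDiffOn_symm isOpen_univ
    hΦ.contDiffOn (mem_univ q₀) _ hΦ'
  have hΦ0 : Φ q₀ = q₀ := by
    have : superpose Q (bvpJet E q₀) = 0 := by
      ext1 t
      change Q (bvpJet E q₀ t) = 0
      rw [hjet0, h0]
    simp only [Φ, this, add_zero]
  have hsymm0 : e.symm q₀ = q₀ := by
    rw [← hΦ0, ← heq, e.left_inv hae, heq, hΦ0]
  have htar : q₀ ∈ e.target := by
    have := e.map_source hae
    rwa [heq, hΦ0] at this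
  let ι : E × E → (E × E) × C(unitInterval, E) := fun q ↦ (q, 0)
  have hι : ContDiff ℝ ∞ ι := contDiff_id.prodMk contDiff_const
  let ψ : E × E → C(unitInterval, E) := fun q ↦ (e.symm (ι q)).2
  have hfst : ∀ q, ι q ∈ e.target → e.symm (ι q) = (q, ψ q) := by
    intro q hq
    have h := e.right_inv hq
    rw [heq] at h
    have h' : (e.symm (ι q)).1 = q := congrArg Prod.fst h
    exact Prod.ext h' rfl
  have hcont : ContinuousAt (fun q ↦ bvpJet E (e.symm (ι q))) (y₀, y₀) := by
    refine (bvpJet E).continuous.continuousAt.comp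
      (ContinuousAt.comp (f := ι) (g := e.symm) ?_ hι.continuous.continuousAt)
    exact e.continuousAt_symm htar
  obtain ⟨ε, hε, hεO⟩ := Metric.mem_nhds_iff.1 hO
  have hjet_mem : ∀ᶠ q in 𝓝 (y₀, y₀), ∀ t, bvpJet E (e.symm (ι q)) t ∈ O := by
    filter_upwards [hcont.eventually (ball_mem_nhds _ hε)] with q hq t
    apply hεO
    have h2 : dist (bvpJet E (e.symm (ι q)) t) (bvpJet E (e.symm (ι (y₀, y₀))) t) < ε :=
      lt_of_le_of_lt (ContinuousMap.dist_apply_le_dist t) hq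
    have h3 : bvpJet E (e.symm (ι (y₀, y₀))) t = (y₀, 0) := by
      have : e.symm (ι (y₀, y₀)) = q₀ := hsymm0
      rw [this, hjet0]
    rwa [h3] at h2
  have htar_ev : ∀ᶠ q in 𝓝 (y₀, y₀), ι q ∈ e.target :=
    hι.continuous.continuousAt.eventually (e.open_target.mem_nhds htar)
  obtain ⟨ρ, hρ, hball⟩ := Metric.eventually_nhds_iff_ball.1 (hjet_mem.and htar_ev)
  rw [← ball_prod_same] at hball
  obtain ⟨ρ₁, hρ₁, hsrc⟩ := Metric.mem_nhds_iff.1 (e.open_source.mem_nhds hae)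
  have hQc : ContinuousAt Q (y₀, 0) := Q.continuous.continuousAt
  obtain ⟨δ, hδ, hQδ⟩ := Metric.continuousAt_iff.1 hQc (ρ₁ / 2) (by positivity)
  set r := min (min (ρ / 2) δ) ρ₁ with hr
  have hrpos : 0 < r := by positivity
  refine ⟨ρ, r, ψ, hrpos, ?_, ?_, ?_, ?_⟩
  · exact lt_of_le_of_lt ((min_le_left _ _).trans (min_le_left _ _)) (by linarith)
  · exact contDiff_snd.comp_contDiffOn
      (hsymm.comp hι.contDiffOn (fun q hq ↦ (hball q hq).2))
  · intro q hq t
    obtain ⟨h2, h3⟩ := hball q hq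
    rw [hfst q h3] at h2
    refine ⟨h2 t, ?_⟩
    have h := e.right_inv h3
    rw [heq, hfst q h3] at h
    have h4 := congrArg (fun z ↦ z.2 t) h
    exact eq_neg_of_add_eq_zero_left h4
  · intro u u' hu
    let c : ℝ → E := fun t ↦ -Q (u t, u' t)
    have hcu : ContinuousOn u (Icc 0 1) := fun t ht ↦ (hu t ht).2.2.1.continuousAt.continuousWithinAt
    have hcu' : ContinuousOn u' (Icc 0 1) :=
      fun t ht ↦ (hu t ht).2.2.2.continuousAt.continuousWithinAt
    have hcc : ContinuousOn c (Icc 0 1) :=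
      (Q.continuous.comp_continuousOn (hcu.prodMk hcu')).neg
    let w : C(unitInterval, E) := ⟨(Icc (0 : ℝ) 1).domRestrict c, hcc.domRestrict⟩
    have hw := bvpCurve_eq_of_hasDerivAt (u := u) (u' := u') (u'' := c)
      (fun t ht ↦ (hu t ht).2.2.1) (fun t ht ↦ (hu t ht).2.2.2) w (fun t ↦ rfl)
    have hjet : ∀ t : unitInterval, bvpJet E ((u 0, u 1), w) t = (u t, u' t) := by
      intro t; rw [bvpJet_apply, hw.1, hw.2]
    have hmem : ((u 0, u 1), w) ∈ e.source := by
      apply hsrc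
      have hrρ : r ≤ ρ₁ := min_le_right _ _
      have hw' : ‖w‖ ≤ ρ₁ / 2 := by
        rw [ContinuousMap.norm_le _ (by positivity)]
        intro t
        have hut := hu t t.2
        have hd : dist (u t, u' t) (y₀, 0) < δ := by
          have hrδ : r ≤ δ := (min_le_left _ _).trans (min_le_right _ _)
          rw [Prod.dist_eq]
          exact max_lt (lt_of_lt_of_le hut.1 hrδ) (lt_of_lt_of_le hut.2.1 hrδ)
        have := (hQδ hd).le
        rw [h0, dist_zero_right] at this
        change ‖-Q (u t, u' t)‖ ≤ _
        rwa [norm_neg]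
      rw [mem_ball, Prod.dist_eq, Prod.dist_eq]
      refine max_lt (max_lt ?_ ?_) ?_
      · exact lt_of_lt_of_le (hu 0 (by simp)).1 hrρ
      · exact lt_of_lt_of_le (hu 1 (by simp)).1 hrρ
      · change dist w 0 < ρ₁
        rw [dist_zero_right]; linarith
    have hew : e ((u 0, u 1), w) = ι (u 0, u 1) := by
      rw [heq]
      refine Prod.ext rfl ?_
      ext1 t
      change -Q (u t, u' t) + Q (bvpJet E ((u 0, u 1), w) t) = 0
      rw [hjet, neg_add_cancel]
    have hψ : ψ (u 0, u 1) = w := by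
      change (e.symm (ι (u 0, u 1))).2 = w
      rw [← hew, e.left_inv hmem]
    rw [hψ]
    exact hjet

end BVP

/-! ### The energy of short geodesics as a function of the end points -/

section Energy

-- the universe is that of `ℝ`, as `contDiff_superpose` is applied to maps from `E × E` to `ℝ`
variable {E : Type} [NormedAddCommGroup E] [NormedSpace ℝ E]

/-- The energy density `(y, v) ↦ ½ g_y(v, v)`. -/
noncomputable def energyDensity (G : C(E, E →L[ℝ] E →L[ℝ] ℝ)) : C(E × E, ℝ) :=
  ⟨fun p ↦ 1 / 2 * G p.1 p.2 p.2, by fun_prop⟩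

/-- The energy `∫₀¹ ½ g_u(u', u')` of a jet `(u, u')` on the unit interval. -/
noncomputable def jetEnergy (G : C(E, E →L[ℝ] E →L[ℝ] ℝ)) (j : C(unitInterval, E × E)) : ℝ :=
  primitive ℝ (superpose (energyDensity G) j) 1

theorem contDiff_energyDensity (G : C(E, E →L[ℝ] E →L[ℝ] ℝ)) (hG : ContDiff ℝ ∞ G) :
    ContDiff ℝ ∞ (energyDensity G) := by
  change ContDiff ℝ ∞ fun p : E × E ↦ 1 / 2 * G p.1 p.2 p.2
  exact contDiff_const.mul (((hG.comp contDiff_fst).clm_apply contDiff_snd).clm_apply contDiff_snd)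

theorem contDiff_jetEnergy (G : C(E, E →L[ℝ] E →L[ℝ] ℝ)) (hG : ContDiff ℝ ∞ G) :
    ContDiff ℝ ∞ (jetEnergy G) :=
  ((ContinuousMap.evalCLM ℝ (1 : unitInterval)).comp (primitive ℝ)).contDiff.comp
    (contDiff_superpose _ (contDiff_energyDensity G hG))

/-- **First variation formula.** If the curves with end points `q` and acceleration `ψ q` satisfy
the geodesic equation of `G`, then the differential of their energy with respect to the end
points only has boundary terms. -/
theorem fderiv_jetEnergy_bvpJet [CompleteSpace E] (G : C(E, E →L[ℝ] E →L[ℝ] ℝ))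
    (hG : ContDiff ℝ ∞ G) {ψ : E × E → C(unitInterval, E)} {q : E × E}
    (hψ : DifferentiableAt ℝ ψ q) (hsymm : ∀ (t : unitInterval) (v w : E),
      G (bvpCurve E (q, ψ q) t) v w = G (bvpCurve E (q, ψ q) t) w v)
    (hgeo : ∀ (t : unitInterval) (z : E), G (bvpCurve E (q, ψ q) t) (ψ q t) z =
      1 / 2 * fderiv ℝ G (bvpCurve E (q, ψ q) t) z (bvpVelocity E (q, ψ q) t)
        (bvpVelocity E (q, ψ q) t) -
      fderiv ℝ G (bvpCurve E (q, ψ q) t) (bvpVelocity E (q, ψ q) t)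
        (bvpVelocity E (q, ψ q) t) z) (δ : E × E) :
    fderiv ℝ (fun q ↦ jetEnergy G (bvpJet E (q, ψ q))) q δ =
      G q.2 (bvpVelocity E (q, ψ q) 1) δ.2 - G q.1 (bvpVelocity E (q, ψ q) 0) δ.1 := by
  set D := fderiv ℝ ψ q with hD
  let L' : C(E × E, E × E →L[ℝ] ℝ) :=
    ⟨fderiv ℝ (energyDensity G), (contDiff_energyDensity G hG).continuous_fderiv (by simp)⟩
  have hL' : ∀ y v z ζ : E, G y ζ v = G y v ζ →
      L' (y, v) (z, ζ) = 1 / 2 * fderiv ℝ G y z v v + G y v ζ := by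
    intro y v z ζ hsymm
    have hGy : HasFDerivAt (fun p : E × E ↦ G p.1) ((fderiv ℝ G y).comp
        (ContinuousLinearMap.fst ℝ E E)) (y, v) :=
      HasFDerivAt.comp (g := G) (f := Prod.fst) (y, v)
        (hG.differentiable (by simp) y).hasFDerivAt hasFDerivAt_fst
    have h1 := ((hGy.clm_apply (hasFDerivAt_snd (𝕜 := ℝ) (p := (y, v)))).clm_apply
      (hasFDerivAt_snd (𝕜 := ℝ) (p := (y, v)))).const_mul (1 / 2 : ℝ)
    change fderiv ℝ (fun p : E × E ↦ 1 / 2 * G p.1 p.2 p.2) (y, v) (z, ζ) = _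
    rw [h1.fderiv]
    simp [hsymm]
    ring
  have hchain : HasFDerivAt (fun q ↦ jetEnergy G (bvpJet E (q, ψ q)))
      (((ContinuousMap.evalCLM ℝ (1 : unitInterval)).comp (primitive ℝ)).comp
        ((pointwiseApply unitInterval (E × E) ℝ (superpose L' (bvpJet E (q, ψ q)))).comp
          ((bvpJet E).comp ((ContinuousLinearMap.id ℝ (E × E)).prod D)))) q := by
    have h1 : HasFDerivAt (fun q ↦ bvpJet E (q, ψ q))
        ((bvpJet E).comp ((ContinuousLinearMap.id ℝ (E × E)).prod D)) q :=
      (bvpJet E).hasFDerivAt.comp q ((hasFDerivAt_id q).prodMk hψ.hasFDerivAt)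
    have h2 := (hasFDerivAt_superpose (energyDensity G) L' (fun x ↦
      ((contDiff_energyDensity G hG).differentiable (by simp) x).hasFDerivAt)
      (bvpJet E (q, ψ q))).comp q h1
    exact ((ContinuousMap.evalCLM ℝ (1 : unitInterval)).comp (primitive ℝ)).hasFDerivAt.comp q h2
  rw [hchain.fderiv]
  set Z : (E × E) × C(unitInterval, E) := (q, ψ q) with hZ
  set X : (E × E) × C(unitInterval, E) := (δ, D δ) with hX
  change primitive ℝ (pointwiseApply unitInterval (E × E) ℝ (superpose L' (bvpJet E Z))
    (bvpJet E X)) 1 = _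
  rw [primitive_apply]
  -- by the geodesic equation, the variation of the energy density is the derivative of `g(u', X)`
  -- for the variation field `X`
  let B : ℝ → ℝ := fun t ↦ G (extend (bvpCurve E Z) t) (extend (bvpVelocity E Z) t)
    (extend (bvpCurve E X) t)
  have hB : ∀ t ∈ Ioo (0 : ℝ) 1, HasDerivAt B (extend (pointwiseApply unitInterval (E × E) ℝ
      (superpose L' (bvpJet E Z)) (bvpJet E X)) t) t := by
    intro t ht
    have hGu : HasDerivAt (fun t ↦ G (extend (bvpCurve E Z) t))
        (fderiv ℝ G (extend (bvpCurve E Z) t) (extend (bvpVelocity E Z) t)) t :=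
      (hG.differentiable (by simp) _).hasFDerivAt.comp_hasDerivAt t
        (hasDerivAt_extend_bvpCurve Z ht)
    have h := (hGu.clm_apply (hasDerivAt_extend_bvpVelocity Z ht)).clm_apply
      (hasDerivAt_extend_bvpCurve X ht)
    refine HasDerivAt.congr_deriv (f := B) h ?_
    symm
    have hI : t ∈ Icc (0 : ℝ) 1 := ⟨ht.1.le, ht.2.le⟩
    have hg := hgeo ⟨t, hI⟩ (extend (bvpCurve E X) t)
    rw [← extend_of_mem _ hI, ← extend_of_mem _ hI, ← extend_of_mem _ hI] at hg
    rw [extend_of_mem _ hI, pointwiseApply_apply]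
    change L' (bvpJet E Z ⟨t, hI⟩) (bvpJet E X ⟨t, hI⟩) = _
    rw [bvpJet_apply, bvpJet_apply, hL' _ _ _ _ (hsymm _ _ _), ← extend_of_mem _ hI,
      ← extend_of_mem _ hI, ← extend_of_mem _ hI, ← extend_of_mem _ hI]
    simp only [add_apply]
    change _ = _ + G (extend (bvpCurve E Z) t) (extend (ψ q) t) _ + _
    rw [hg]
    ring
  have hBc : ContinuousOn B (Icc 0 1) := by
    have h1 := continuous_extend (bvpCurve E Z)
    have h2 := continuous_extend (bvpVelocity E Z)
    have h3 := continuous_extend (bvpCurve E X)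
    exact (((G.continuous.comp h1).clm_apply h2).clm_apply h3).continuousOn
  rw [show ((1 : unitInterval) : ℝ) = 1 from rfl,
    intervalIntegral.integral_eq_sub_of_hasDerivAt_of_le zero_le_one hBc hB
      ((continuous_extend _).intervalIntegrable _ _)]
  have e1 : ∀ w : C(unitInterval, E), extend w 1 = w 1 := fun w ↦ extend_coe w 1
  have e0 : ∀ w : C(unitInterval, E), extend w 0 = w 0 := fun w ↦ extend_coe w 0
  simp only [B, e1, e0, bvpCurve_zero, bvpCurve_one]
  simp [hZ, hX]

end Energy

/-! ### The metric in a chart -/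

section Chart

variable {n : ℕ} {M : Type*} [TopologicalSpace M] [ChartedSpace (EuclideanSpace ℝ (Fin n)) M]
  [IsManifold (𝓡 n) ∞ M]

/-- The differential at `y` of the inverse of the chart at `p`, with values in the tangent space
of `M`. -/
noncomputable def chartFrame (p : M) (y : EuclideanSpace ℝ (Fin n)) :
    EuclideanSpace ℝ (Fin n) →L[ℝ] TangentSpace (𝓡 n) ((extChartAt (𝓡 n) p).symm y) :=
  mfderiv 𝓘(ℝ, EuclideanSpace ℝ (Fin n)) (𝓡 n) (extChartAt (𝓡 n) p).symm y

theorem mdifferentiableAt_chart {p q : M} (hq : q ∈ (extChartAt (𝓡 n) p).source) :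
    MDifferentiableAt (𝓡 n) 𝓘(ℝ, EuclideanSpace ℝ (Fin n)) (extChartAt (𝓡 n) p) q := by
  rw [extChartAt_source] at hq
  exact (contMDiffAt_extChartAt' (n := ∞) hq).mdifferentiableAt (by simp)

theorem mdifferentiableAt_chart_symm {p : M} {y : EuclideanSpace ℝ (Fin n)}
    (hy : y ∈ (extChartAt (𝓡 n) p).target) :
    MDifferentiableAt 𝓘(ℝ, EuclideanSpace ℝ (Fin n)) (𝓡 n) (extChartAt (𝓡 n) p).symm y :=
  ((contMDiffOn_extChartAt_symm (n := ∞) p).contMDiffAt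
    ((isOpen_extChartAt_target p).mem_nhds hy)).mdifferentiableAt (by simp)

theorem chartMetric_apply (g : RiemannianMetric n M) (p : M) (y v w : EuclideanSpace ℝ (Fin n)) :
    chartMetric g p y v w =
      g.inner ((extChartAt (𝓡 n) p).symm y) (chartFrame p y v) (chartFrame p y w) := rfl

theorem chartFrame_injective {p : M} {y : EuclideanSpace ℝ (Fin n)}
    (hy : y ∈ (extChartAt (𝓡 n) p).target) : Function.Injective (chartFrame p y) := by
  have h := mfderiv_extChartAt_comp_mfderivWithin_extChartAt_symm (I := 𝓡 n) hy
  rw [ModelWithCorners.range_eq_univ, mfderivWithin_univ] at h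
  intro v w hvw
  have : ∀ z, (mfderiv (𝓡 n) 𝓘(ℝ, EuclideanSpace ℝ (Fin n)) (extChartAt (𝓡 n) p)
      ((extChartAt (𝓡 n) p).symm y)) (chartFrame p y z) = z := fun z ↦ congrArg (fun A ↦ A z) h
  rw [← this v, ← this w, hvw]

theorem chartMetric_symm (g : RiemannianMetric n M) (p : M) (y v w : EuclideanSpace ℝ (Fin n)) :
    chartMetric g p y v w = chartMetric g p y w v := g.symm _ _ _

theorem chartMetric_pos (g : RiemannianMetric n M) {p : M} {y : EuclideanSpace ℝ (Fin n)}
    (hy : y ∈ (extChartAt (𝓡 n) p).target) {v : EuclideanSpace ℝ (Fin n)} (hv : v ≠ 0) :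
    0 < chartMetric g p y v v := by
  refine g.pos _ _ fun h ↦ hv (chartFrame_injective hy ?_)
  rw [map_zero]; exact h

/-- The chain rule for a map into `M` read in the chart at `p`. -/
theorem chartFrame_fderiv {F : Type*} [NormedAddCommGroup F] [NormedSpace ℝ F] {h : F → M} {z : F}
    (hh : MDifferentiableAt 𝓘(ℝ, F) (𝓡 n) h z) {p : M} (hz : h z ∈ (extChartAt (𝓡 n) p).source)
    (ζ : F) :
    chartFrame p (extChartAt (𝓡 n) p (h z)) (fderiv ℝ (fun x ↦ extChartAt (𝓡 n) p (h x)) z ζ) =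
      mfderiv 𝓘(ℝ, F) (𝓡 n) h z ζ := by
  have hy : extChartAt (𝓡 n) p (h z) ∈ (extChartAt (𝓡 n) p).target :=
    (extChartAt (𝓡 n) p).map_source hz
  have h1 : MDifferentiableAt 𝓘(ℝ, F) 𝓘(ℝ, EuclideanSpace ℝ (Fin n))
      (fun x ↦ extChartAt (𝓡 n) p (h x)) z := (mdifferentiableAt_chart hz).comp z hh
  have h2 := mfderiv_comp z (mdifferentiableAt_chart_symm hy) h1
  have h3 : ((extChartAt (𝓡 n) p).symm ∘ fun x ↦ extChartAt (𝓡 n) p (h x)) =ᶠ[𝓝 z] h := by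
    filter_upwards [hh.continuousAt.eventually ((isOpen_extChartAt_source p).mem_nhds hz)] with x hx
    exact (extChartAt (𝓡 n) p).left_inv hx
  have h4 := h3.mfderiv_eq (I := 𝓘(ℝ, F)) (I' := 𝓡 n)
  rw [mfderiv_eq_fderiv] at h2
  have h5 := congrArg (fun A ↦ A ζ) (h2.symm.trans h4)
  exact h5

/-- The metric is smooth in charts: the coordinate vector fields are constant in the trivialization
of the tangent bundle which belongs to the chart. -/
theorem contDiffOn_chartMetric (g : RiemannianMetric n M) (p : M) :
    ContDiffOn ℝ ∞ (chartMetric g p) (extChartAt (𝓡 n) p).target := by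
  rw [contDiffOn_clm_apply]
  intro v
  rw [contDiffOn_clm_apply]
  intro w
  rw [← contMDiffOn_iff_contDiffOn]
  have hb : ContMDiffOn 𝓘(ℝ, EuclideanSpace ℝ (Fin n)) (𝓡 n) ∞ (extChartAt (𝓡 n) p).symm
    (extChartAt (𝓡 n) p).target := contMDiffOn_extChartAt_symm p
  have hg := g.contMDiff.comp_contMDiffOn hb
  have hsec : ∀ v, ContMDiffOn 𝓘(ℝ, EuclideanSpace ℝ (Fin n)) ((𝓡 n).tangent) ∞
      (fun y ↦ Bundle.TotalSpace.mk' (EuclideanSpace ℝ (Fin n))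
        (E := fun x : M ↦ TangentSpace (𝓡 n) x)
        ((extChartAt (𝓡 n) p).symm y) (chartFrame p y v)) (extChartAt (𝓡 n) p).target := by
    intro v
    set e := trivializationAt (EuclideanSpace ℝ (Fin n)) (fun x : M ↦ TangentSpace (𝓡 n) x) p
    have hmem : ∀ y ∈ (extChartAt (𝓡 n) p).target,
        (extChartAt (𝓡 n) p).symm y ∈ (chartAt (EuclideanSpace ℝ (Fin n)) p).source := by
      intro y hy
      rw [← extChartAt_source (𝓡 n)]
      exact (extChartAt (𝓡 n) p).map_target hy
    refine (e.contMDiffOn_iff (fun y hy ↦ ?_)).2 ⟨hb, ?_⟩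
    · rw [e.mem_source]; exact hmem y hy
    · refine (contMDiffOn_const (c := v)).congr fun y hy ↦ ?_
      have h1 := TangentBundle.continuousLinearMapAt_trivializationAt (I := 𝓡 n) (hmem y hy)
      have h2 := e.coe_linearMapAt_of_mem (R := ℝ) (b := (extChartAt (𝓡 n) p).symm y) (hmem y hy)
      have h3 := congrFun h2 (chartFrame p y v)
      rw [← Bundle.Trivialization.continuousLinearMapAt_apply, h1] at h3
      have h4 := mfderiv_extChartAt_comp_mfderivWithin_extChartAt_symm (I := 𝓡 n) hy
      rw [ModelWithCorners.range_eq_univ, mfderivWithin_univ] at h4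
      have h5 := congrArg (fun A ↦ A v) h4
      exact h3.symm.trans h5
  have h := ContMDiffOn.clm_bundle_apply₂ (E₃ := fun _ ↦ ℝ) (F₃ := ℝ) hg (hsec v) (hsec w)
  intro y hy
  have h2 := h y hy
  simp only [Bundle.contMDiffWithinAt_totalSpace] at h2
  exact h2.2

end Chart

/-! ### The Christoffel symbols in a chart -/

/-- A smooth map on an open set can be modified away from a given point to a smooth map on the
whole space. -/
theorem exists_contDiff_eqOn_ball {V F : Type*} [NormedAddCommGroup V] [NormedSpace ℝ V]
    [HasContDiffBump V] [FiniteDimensional ℝ V] [NormedAddCommGroup F] [NormedSpace ℝ F]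
    {f : V → F} {U : Set V} (hU : IsOpen U) (hf : ContDiffOn ℝ ∞ f U) {c : V} (hc : c ∈ U) :
    ∃ (f₁ : C(V, F)) (R : ℝ), ContDiff ℝ ∞ f₁ ∧ 0 < R ∧ ball c R ⊆ U ∧ EqOn f₁ f (ball c R) := by
  obtain ⟨R, hR, hball⟩ := Metric.isOpen_iff.1 hU c hc
  let χ : ContDiffBump c := ⟨R / 4, R / 2, by positivity, by linarith⟩
  have hsm : ContDiff ℝ ∞ fun x ↦ χ x • f x := by
    rw [contDiff_iff_contDiffAt]
    intro x
    by_cases hx : x ∈ ball c R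
    · exact χ.contDiff.contDiffAt.smul (hf.contDiffAt (hU.mem_nhds (hball hx)))
    · have hx' : x ∉ tsupport χ := by
        rw [χ.tsupport_eq]
        intro h
        exact hx (closedBall_subset_ball (by change R / 2 < R; linarith) h)
      refine (contDiffAt_const (c := (0 : F))).congr_of_eventuallyEq ?_
      filter_upwards [(isClosed_tsupport χ).isOpen_compl.mem_nhds hx'] with y hy
      rw [image_eq_zero_of_notMem_tsupport hy, zero_smul]
  refine ⟨⟨_, hsm.continuous⟩, R / 4, hsm, by positivity,
    (ball_subset_ball (by linarith)).trans hball, fun x hx ↦ ?_⟩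
  change χ x • f x = f x
  rw [χ.one_of_mem_closedBall (ball_subset_closedBall hx), one_smul]

theorem contDiffOn_fderiv_fst_apply {V F : Type*} [NormedAddCommGroup V] [NormedSpace ℝ V]
    [NormedAddCommGroup F] [NormedSpace ℝ F] {G : V → F} {U : Set V} (hU : IsOpen U)
    (hG : ContDiffOn ℝ ∞ G U) {v : V × V → V} (hv : ContDiffOn ℝ ∞ v (U ×ˢ univ)) :
    ContDiffOn ℝ ∞ (fun x : V × V ↦ fderiv ℝ G x.1 (v x)) (U ×ˢ univ) := by
  have hD : ContDiffOn ℝ ∞ (fun x : V × V ↦ fderiv ℝ G x.1) (U ×ˢ univ) :=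
    ContDiffOn.comp (g := fderiv ℝ G) (t := U) (hG.fderiv_of_isOpen (m := ∞) hU (by exact le_rfl))
      contDiff_fst.contDiffOn fun x hx ↦ hx.1
  exact hD.clm_apply hv

theorem contDiffOn_fderiv_quadratic {V : Type*} [NormedAddCommGroup V] [NormedSpace ℝ V]
    {G : V → V →L[ℝ] V →L[ℝ] ℝ} {U : Set V} (hU : IsOpen U) (hG : ContDiffOn ℝ ∞ G U) (z : V) :
    ContDiffOn ℝ ∞ (fun x : V × V ↦ fderiv ℝ G x.1 x.2 x.2 z - 1 / 2 * fderiv ℝ G x.1 z x.2 x.2)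
      (U ×ˢ univ) := by
  have hs : ContDiffOn ℝ ∞ (Prod.snd : V × V → V) (U ×ˢ univ) := contDiff_snd.contDiffOn
  have h1 := contDiffOn_fderiv_fst_apply hU hG hs
  have h2 := contDiffOn_fderiv_fst_apply hU hG
    (contDiffOn_const (c := z) : ContDiffOn ℝ ∞ (fun _ : V × V ↦ z) (U ×ˢ univ))
  exact ((h1.clm_apply hs).clm_apply contDiffOn_const).sub
    (contDiffOn_const.mul ((h2.clm_apply hs).clm_apply hs))

/-- A map which is homogeneous of degree two in the second variable has vanishing differential
where this variable is zero. -/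
theorem fderiv_eq_zero_of_homogeneous {V F : Type*} [NormedAddCommGroup V] [NormedSpace ℝ V]
    [NormedAddCommGroup F] [NormedSpace ℝ F] {Q : V × V → F} {y : V}
    (hd : ∀ v, DifferentiableAt ℝ Q (y, v)) (hQ : ∀ y v (c : ℝ), Q (y, c • v) = c ^ 2 • Q (y, v)) :
    fderiv ℝ Q (y, 0) = 0 := by
  -- along each line through `(y, 0)` the map is `t ^ 2` times a differentiable function
  refine ContinuousLinearMap.ext fun ⟨δ, v⟩ ↦ ?_
  have ht := hasDerivAt_id (0 : ℝ)
  have hδ : HasDerivAt (fun t : ℝ ↦ y + t • δ) δ 0 := by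
    simpa using (ht.smul_const δ).const_add y
  have hv : HasDerivAt (fun t : ℝ ↦ t • v) v 0 := by simpa using ht.smul_const v
  have h3 := HasFDerivAt.comp_hasDerivAt_of_eq (l := Q) (0 : ℝ) (hd 0).hasFDerivAt
    (hδ.prodMk hv) (by simp)
  have h5 := HasFDerivAt.comp_hasDerivAt_of_eq (l := Q) (0 : ℝ) (hd v).hasFDerivAt
    (hδ.prodMk (hasDerivAt_const (0 : ℝ) v)) (by simp)
  have h6 := (ht.pow 2).smul h5
  have h7 : (Q ∘ fun t : ℝ ↦ (y + t • δ, t • v)) =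
      (id ^ 2 : ℝ → ℝ) • (Q ∘ fun t : ℝ ↦ (y + t • δ, v)) := by
    funext t
    simpa using hQ (y + t • δ) v t
  rw [h7] at h3
  rw [h3.unique h6]
  simp

section Christoffel

variable {n : ℕ} {M : Type*} [TopologicalSpace M] [ChartedSpace (EuclideanSpace ℝ (Fin n)) M]
  [IsManifold (𝓡 n) ∞ M]

theorem isInvertible_chartMetric (g : RiemannianMetric n M) {p : M} {y : EuclideanSpace ℝ (Fin n)}
    (hy : y ∈ (extChartAt (𝓡 n) p).target) : (chartMetric g p y).IsInvertible := by
  have hinj : Function.Injective (chartMetric g p y) := by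
    rw [injective_iff_map_eq_zero]
    intro v hv
    by_contra hne
    have := chartMetric_pos g hy hne
    rw [hv] at this
    simp at this
  have hfin : Module.finrank ℝ (EuclideanSpace ℝ (Fin n)) =
      Module.finrank ℝ (EuclideanSpace ℝ (Fin n) →L[ℝ] ℝ) := by
    have h1 := (LinearMap.toContinuousLinearMap (𝕜 := ℝ) (E := EuclideanSpace ℝ (Fin n))
      (F' := ℝ)).finrank_eq
    rw [← h1]
    exact (Subspace.dual_finrank_eq (K := ℝ) (V := EuclideanSpace ℝ (Fin n))).symm
  let e := LinearEquiv.ofInjectiveOfFinrankEq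
    (chartMetric g p y : EuclideanSpace ℝ (Fin n) →ₗ[ℝ] EuclideanSpace ℝ (Fin n) →L[ℝ] ℝ) hinj hfin
  exact ⟨e.toContinuousLinearEquiv, by ext v w; rfl⟩

theorem chartMetric_christoffel (g : RiemannianMetric n M) {p : M}
    {y : EuclideanSpace ℝ (Fin n)} (hy : y ∈ (extChartAt (𝓡 n) p).target)
    (v w : EuclideanSpace ℝ (Fin n)) :
    chartMetric g p y (christoffel g p y v w) = christoffelFirst g p y v w := by
  obtain ⟨e, he⟩ := isInvertible_chartMetric g hy
  rw [christoffel, ← he, ContinuousLinearMap.inverse_equiv]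
  simp

theorem christoffelFirst_self_apply (g : RiemannianMetric n M) (p : M)
    (y v z : EuclideanSpace ℝ (Fin n)) : christoffelFirst g p y v v z =
      fderiv ℝ (chartMetric g p) y v v z - 1 / 2 * fderiv ℝ (chartMetric g p) y z v v := by
  simp [christoffelFirst]
  ring

/-- The quadratic form of the Christoffel symbols is homogeneous. -/
theorem christoffel_smul_smul (g : RiemannianMetric n M) (p : M)
    (y v : EuclideanSpace ℝ (Fin n)) (c : ℝ) :
    christoffel g p y (c • v) (c • v) = c ^ 2 • christoffel g p y v v := by
  have h : christoffelFirst g p y (c • v) (c • v) = c ^ 2 • christoffelFirst g p y v v := by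
    ext z
    simp only [smul_apply, christoffelFirst_self_apply, map_smul, smul_eq_mul]
    ring
  rw [christoffel, h, map_smul, christoffel]

theorem contDiffOn_christoffel (g : RiemannianMetric n M) (p : M) :
    ContDiffOn ℝ ∞ (fun x : EuclideanSpace ℝ (Fin n) × EuclideanSpace ℝ (Fin n) ↦
      christoffel g p x.1 x.2 x.2) ((extChartAt (𝓡 n) p).target ×ˢ univ) := by
  have hG := contDiffOn_chartMetric g p
  have hfst : MapsTo (Prod.fst : EuclideanSpace ℝ (Fin n) × EuclideanSpace ℝ (Fin n) → _)
      ((extChartAt (𝓡 n) p).target ×ˢ univ) (extChartAt (𝓡 n) p).target := fun x hx ↦ hx.1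
  have hinv : ContDiffOn ℝ ∞ (fun x : EuclideanSpace ℝ (Fin n) × EuclideanSpace ℝ (Fin n) ↦
      (chartMetric g p x.1).inverse) ((extChartAt (𝓡 n) p).target ×ˢ univ) := by
    intro x hx
    exact ((isInvertible_chartMetric g hx.1).contDiffAt_map_inverse).comp_contDiffWithinAt x
      (hG.comp contDiff_fst.contDiffOn hfst x hx)
  have hC : ContDiffOn ℝ ∞ (fun x : EuclideanSpace ℝ (Fin n) × EuclideanSpace ℝ (Fin n) ↦
      christoffelFirst g p x.1 x.2 x.2) ((extChartAt (𝓡 n) p).target ×ˢ univ) := by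
    rw [contDiffOn_clm_apply]
    intro z
    simp only [christoffelFirst_self_apply]
    exact contDiffOn_fderiv_quadratic (isOpen_extChartAt_target p) hG z
  exact hinv.clm_apply hC

theorem christoffel_zero (g : RiemannianMetric n M) (p : M) (y : EuclideanSpace ℝ (Fin n)) :
    christoffel g p y 0 0 = 0 := by
  have := christoffel_smul_smul g p y 0 0
  simpa using this

theorem fderiv_christoffel_zero (g : RiemannianMetric n M) {p : M} {y : EuclideanSpace ℝ (Fin n)}
    (hy : y ∈ (extChartAt (𝓡 n) p).target) :
    fderiv ℝ (fun x : EuclideanSpace ℝ (Fin n) × EuclideanSpace ℝ (Fin n) ↦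
      christoffel g p x.1 x.2 x.2) (y, 0) = 0 := by
  have hO : IsOpen ((extChartAt (𝓡 n) p).target ×ˢ
      (univ : Set (EuclideanSpace ℝ (Fin n)))) := (isOpen_extChartAt_target p).prod isOpen_univ
  have hd : ∀ v, DifferentiableAt ℝ (fun x : EuclideanSpace ℝ (Fin n) × EuclideanSpace ℝ (Fin n) ↦
      christoffel g p x.1 x.2 x.2) (y, v) := fun v ↦
    ((contDiffOn_christoffel g p).contDiffAt (hO.mem_nhds ⟨hy, mem_univ v⟩)).differentiableAt
      (by simp)
  exact fderiv_eq_zero_of_homogeneous (Q := fun x : EuclideanSpace ℝ (Fin n) ×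
    EuclideanSpace ℝ (Fin n) ↦ christoffel g p x.1 x.2 x.2) hd
    (fun y v c ↦ christoffel_smul_smul g p y v c)

end Christoffel

/-! ### Geodesics in a chart -/

section Geodesic

variable {n : ℕ} {M : Type*} [TopologicalSpace M] [ChartedSpace (EuclideanSpace ℝ (Fin n)) M]
  [IsManifold (𝓡 n) ∞ M]

/-- The coordinate expression of the curve `γ` in the chart at `p`. -/
noncomputable def chartCurve (p : M) (γ : ℝ → M) (t : ℝ) : EuclideanSpace ℝ (Fin n) :=
  extChartAt (𝓡 n) p (γ t)

/-- The square of the speed of a curve. -/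
noncomputable def speedSq (g : RiemannianMetric n M) (γ : ℝ → M) (t : ℝ) : ℝ :=
  g.inner (γ t) (velocity (n := n) γ t) (velocity (n := n) γ t)

theorem chartFrame_deriv_chartCurve {γ : ℝ → M} (hγ : ContMDiff 𝓘(ℝ, ℝ) (𝓡 n) ∞ γ) {p : M} {t : ℝ}
    (ht : γ t ∈ (extChartAt (𝓡 n) p).source) :
    chartFrame p (chartCurve p γ t) (deriv (chartCurve p γ) t) = velocity (n := n) γ t :=
  chartFrame_fderiv ((hγ t).mdifferentiableAt (by simp)) ht (1 : ℝ)

theorem contDiffAt_chartCurve {γ : ℝ → M} (hγ : ContMDiff 𝓘(ℝ, ℝ) (𝓡 n) ∞ γ) {p : M} {t : ℝ}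
    (ht : γ t ∈ (extChartAt (𝓡 n) p).source) : ContDiffAt ℝ ∞ (chartCurve (n := n) p γ) t := by
  rw [← contMDiffAt_iff_contDiffAt]
  rw [extChartAt_source] at ht
  exact (contMDiffAt_extChartAt' (n := ∞) ht).comp t (hγ t)

/-- The square of the speed, computed in the chart at `p`. -/
theorem chartMetric_deriv_chartCurve (g : RiemannianMetric n M) {γ : ℝ → M}
    (hγ : ContMDiff 𝓘(ℝ, ℝ) (𝓡 n) ∞ γ) {p : M} {t : ℝ}
    (ht : γ t ∈ (extChartAt (𝓡 n) p).source) :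
    chartMetric g p (chartCurve p γ t) (deriv (chartCurve p γ) t) (deriv (chartCurve p γ) t) =
      speedSq g γ t := by
  have h2 : (extChartAt (𝓡 n) p).symm (chartCurve p γ t) = γ t := (extChartAt (𝓡 n) p).left_inv ht
  rw [chartMetric_apply, chartFrame_deriv_chartCurve hγ ht, speedSq, h2]

end Geodesic

section Geodesic

variable {n : ℕ} {M : Type*} [TopologicalSpace M] [ChartedSpace (EuclideanSpace ℝ (Fin n)) M]
  [IsManifold (𝓡 n) ∞ M]

theorem hasDerivAt_chartCurve {γ : ℝ → M} (hγ : ContMDiff 𝓘(ℝ, ℝ) (𝓡 n) ∞ γ) {p : M} {t : ℝ}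
    (ht : γ t ∈ (extChartAt (𝓡 n) p).source) :
    HasDerivAt (chartCurve (n := n) p γ) (deriv (chartCurve p γ) t) t :=
  ((contDiffAt_chartCurve hγ ht).differentiableAt (by simp)).hasDerivAt

/-- The geodesic equation in the chart at `p`. -/
theorem IsPeriodicGeodesic.hasDerivAt_deriv_chartCurve {g : RiemannianMetric n M}
    {x : C(UnitAddCircle, M)} (hx : IsPeriodicGeodesic g x) {p : M} {t : ℝ}
    (ht : toCurve x t ∈ (extChartAt (𝓡 n) p).source) :
    HasDerivAt (deriv (chartCurve (n := n) p (toCurve x)))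
      (-christoffel g p (chartCurve p (toCurve x) t) (deriv (chartCurve p (toCurve x)) t)
        (deriv (chartCurve p (toCurve x)) t)) t := by
  have h1 : ContDiffAt ℝ ∞ (deriv (chartCurve (n := n) p (toCurve x))) t :=
    ((contDiffAt_chartCurve hx.1 ht).fderiv_right (m := ∞) (by exact le_rfl)).clm_apply
      contDiffAt_const
  have h2 := (h1.differentiableAt (by simp)).hasDerivAt
  exact h2.congr_deriv (eq_neg_of_add_eq_zero_left (hx.2 p t ht))

/-- Geodesics have constant speed. -/
theorem IsPeriodicGeodesic.speedSq_eq {g : RiemannianMetric n M}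
    {x : C(UnitAddCircle, M)} (hx : IsPeriodicGeodesic g x) (s t : ℝ) :
    speedSq g (toCurve x) s = speedSq g (toCurve x) t := by
  have key : ∀ t, HasDerivAt (speedSq g (toCurve x)) 0 t := by
    intro t
    set p := toCurve x t with hp
    have ht : toCurve x t ∈ (extChartAt (𝓡 n) p).source := mem_extChartAt_source p
    have hG : HasFDerivAt (chartMetric g p) (fderiv ℝ (chartMetric g p)
        (chartCurve p (toCurve x) t)) (chartCurve p (toCurve x) t) :=
      (((contDiffOn_chartMetric g p).contDiffAt ((isOpen_extChartAt_target p).mem_nhds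
        ((extChartAt (𝓡 n) p).map_source ht))).differentiableAt (by simp)).hasFDerivAt
    have hGu := HasFDerivAt.comp_hasDerivAt (l := chartMetric g p)
      (f := chartCurve p (toCurve x)) t hG (hasDerivAt_chartCurve hx.1 ht)
    have hu' := hx.hasDerivAt_deriv_chartCurve ht
    have h := (hGu.clm_apply hu').clm_apply hu'
    have hev : speedSq g (toCurve x) =ᶠ[𝓝 t] fun s ↦ chartMetric g p (chartCurve p (toCurve x) s)
        (deriv (chartCurve p (toCurve x)) s) (deriv (chartCurve p (toCurve x)) s) := by
      filter_upwards [hx.1.continuous.continuousAt.eventually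
        ((isOpen_extChartAt_source p).mem_nhds ht)] with s hs
      exact (chartMetric_deriv_chartCurve g hx.1 hs).symm
    refine (h.congr_of_eventuallyEq hev).congr_deriv ?_
    have hy := (extChartAt (𝓡 n) p).map_source ht
    simp only [add_apply, map_neg, Function.comp_apply]
    rw [chartMetric_symm g p _ (deriv (chartCurve p (toCurve x)) t)]
    have h3 := chartMetric_christoffel g hy (deriv (chartCurve p (toCurve x)) t)
      (deriv (chartCurve p (toCurve x)) t)
    have h4 := congrArg (fun A ↦ A (deriv (chartCurve p (toCurve x)) t)) h3
    simp only [christoffelFirst_self_apply] at h4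
    simp only [neg_apply]
    change _ + -(chartMetric g p (extChartAt (𝓡 n) p (toCurve x t)) _ _) +
      -(chartMetric g p (extChartAt (𝓡 n) p (toCurve x t)) _ _) = _
    change chartMetric g p (extChartAt (𝓡 n) p (toCurve x t)) _ _ = _ at h4
    rw [show chartCurve p (toCurve x) t = extChartAt (𝓡 n) p (toCurve x t) from rfl]
    rw [h4]
    ring
  exact is_const_of_deriv_eq_zero (fun t ↦ (key t).differentiableAt) (fun t ↦ (key t).deriv) s t

theorem speedSq_nonneg (g : RiemannianMetric n M) (γ : ℝ → M) (t : ℝ) : 0 ≤ speedSq g γ t := by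
  by_cases h : velocity (n := n) γ t = 0
  · simp [speedSq, h]
  · exact (g.pos _ _ h).le

/-- The length of a periodic geodesic is its speed. -/
theorem IsPeriodicGeodesic.loopLength_eq {g : RiemannianMetric n M}
    {x : C(UnitAddCircle, M)} (hx : IsPeriodicGeodesic g x) (t : ℝ) :
    loopLength g x = Real.sqrt (speedSq g (toCurve x) t) := by
  have : ∀ s, Real.sqrt (g.inner (toCurve x s) (velocity (toCurve x) s) (velocity (toCurve x) s)) =
      Real.sqrt (speedSq g (toCurve x) t) := fun s ↦ congrArg _ (hx.speedSq_eq s t)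
  simp [loopLength, this]

theorem IsPeriodicGeodesic.speedSq_eq_loopLength_sq {g : RiemannianMetric n M}
    {x : C(UnitAddCircle, M)} (hx : IsPeriodicGeodesic g x) (t : ℝ) :
    speedSq g (toCurve x) t = loopLength g x ^ 2 := by
  rw [hx.loopLength_eq t, Real.sq_sqrt (speedSq_nonneg _ _ _)]

/-! ### Families of short geodesic arcs -/

/-- A smooth family of geodesic arcs in the chart at `p`, close to the point with coordinates `y₀`,
parametrized by their end points. The arcs run over the time interval `[0, 1]`, and `accel` is
their coordinate acceleration. The family contains all geodesic arcs which stay within distance `r`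
of `y₀` and have velocity less than `r`. The function `energy` is their energy; only its
differential and its value on arcs of constant speed are recorded. -/
structure GeodesicFamily (g : RiemannianMetric n M) (p : M) (y₀ : EuclideanSpace ℝ (Fin n)) where
  /-- The end points range over the ball of this radius. -/
  radius : ℝ
  /-- All slow geodesic arcs in the ball of this smaller radius belong to the family. -/
  r : ℝ
  /-- The acceleration of the arc with given end points. -/
  accel : EuclideanSpace ℝ (Fin n) × EuclideanSpace ℝ (Fin n) →
    C(unitInterval, EuclideanSpace ℝ (Fin n))
  /-- The energy of the arc with given end points. -/
  energy : EuclideanSpace ℝ (Fin n) × EuclideanSpace ℝ (Fin n) → ℝ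
  r_pos : 0 < r
  r_lt : r < radius
  contDiffOn_accel : ContDiffOn ℝ ∞ accel (ball y₀ radius ×ˢ ball y₀ radius)
  mem_target : ∀ q ∈ ball y₀ radius ×ˢ ball y₀ radius, ∀ t,
    bvpCurve _ (q, accel q) t ∈ (extChartAt (𝓡 n) p).target
  geodesic : ∀ q ∈ ball y₀ radius ×ˢ ball y₀ radius, ∀ t,
    accel q t = -christoffel g p (bvpCurve _ (q, accel q) t) (bvpVelocity _ (q, accel q) t)
      (bvpVelocity _ (q, accel q) t)
  unique : ∀ u u' : ℝ → EuclideanSpace ℝ (Fin n),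
    (∀ t ∈ Icc (0 : ℝ) 1, u t ∈ ball y₀ r ∧ u' t ∈ ball 0 r ∧ HasDerivAt u (u' t) t ∧
      HasDerivAt u' (-christoffel g p (u t) (u' t) (u' t)) t) →
    ∀ t : unitInterval, bvpCurve _ ((u 0, u 1), accel (u 0, u 1)) t = u t ∧
      bvpVelocity _ ((u 0, u 1), accel (u 0, u 1)) t = u' t
  contDiffOn_energy : ContDiffOn ℝ ∞ energy (ball y₀ radius ×ˢ ball y₀ radius)
  fderiv_energy : ∀ q ∈ ball y₀ radius ×ˢ ball y₀ radius, ∀ δ,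
    fderiv ℝ energy q δ = chartMetric g p q.2 (bvpVelocity _ (q, accel q) 1) δ.2 -
      chartMetric g p q.1 (bvpVelocity _ (q, accel q) 0) δ.1
  energy_eq : ∀ q ∈ ball y₀ radius ×ˢ ball y₀ radius, ∀ c : ℝ,
    (∀ t, chartMetric g p (bvpCurve _ (q, accel q) t) (bvpVelocity _ (q, accel q) t)
      (bvpVelocity _ (q, accel q) t) = c) → energy q = c / 2

/-- Families of short geodesic arcs exist near each point: `exists_bvp_family` is applied to the
Christoffel symbols, which are smoothly extended to the whole space. -/
theorem nonempty_geodesicFamily (g : RiemannianMetric n M) (p : M)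
    {y₀ : EuclideanSpace ℝ (Fin n)} (hy₀ : y₀ ∈ (extChartAt (𝓡 n) p).target) :
    Nonempty (GeodesicFamily g p y₀) := by
  have hO : IsOpen ((extChartAt (𝓡 n) p).target ×ˢ
      (univ : Set (EuclideanSpace ℝ (Fin n)))) := (isOpen_extChartAt_target p).prod isOpen_univ
  obtain ⟨Q, R, hQ, hR, -, hQeq⟩ := exists_contDiff_eqOn_ball hO (contDiffOn_christoffel g p)
    (c := (y₀, 0)) ⟨hy₀, mem_univ _⟩
  obtain ⟨G, R', hG, hR', hR't, hGeq⟩ := exists_contDiff_eqOn_ball (isOpen_extChartAt_target p)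
    (contDiffOn_chartMetric g p) hy₀
  have hQ0 : Q (y₀, 0) = 0 := by
    rw [hQeq (mem_ball_self hR)]; exact christoffel_zero g p y₀
  have hQ1 : fderiv ℝ Q (y₀, 0) = 0 := by
    rw [(hQeq.eventuallyEq_of_mem (ball_mem_nhds _ hR)).fderiv_eq]
    exact fderiv_christoffel_zero g hy₀
  have hmem : ball (y₀, (0 : EuclideanSpace ℝ (Fin n))) R ∩ Prod.fst ⁻¹' ball y₀ R' ∈
      𝓝 (y₀, (0 : EuclideanSpace ℝ (Fin n))) :=
    inter_mem (ball_mem_nhds _ hR) (continuous_fst.continuousAt (ball_mem_nhds _ hR'))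
  obtain ⟨ρ, r, ψ, hr, hrρ, hψ, hfam, huniq⟩ := exists_bvp_family Q hQ y₀ hQ0 hQ1 hmem
  have hN : IsOpen (ball y₀ ρ ×ˢ ball y₀ ρ) := isOpen_ball.prod isOpen_ball
  have hcurve : ∀ q ∈ ball y₀ ρ ×ˢ ball y₀ ρ, ∀ t, bvpCurve _ (q, ψ q) t ∈ ball y₀ R' := by
    intro q hq t
    have := (hfam q hq t).1.2
    rwa [bvpJet_apply] at this
  have hgeo : ∀ q ∈ ball y₀ ρ ×ˢ ball y₀ ρ, ∀ t,
    ψ q t = -christoffel g p (bvpCurve _ (q, ψ q) t) (bvpVelocity _ (q, ψ q) t)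
      (bvpVelocity _ (q, ψ q) t) := by
    intro q hq t
    rw [(hfam q hq t).2, hQeq (hfam q hq t).1.1, bvpJet_apply]
  have hG1 : ∀ y ∈ ball y₀ R', fderiv ℝ G y = fderiv ℝ (chartMetric g p) y := fun y hy ↦
    (hGeq.eventuallyEq_of_mem (isOpen_ball.mem_nhds hy)).fderiv_eq
  have hψjet : ContDiffOn ℝ ∞ (fun q ↦ bvpJet _ (q, ψ q)) (ball y₀ ρ ×ˢ ball y₀ ρ) :=
    (bvpJet (EuclideanSpace ℝ (Fin n))).contDiff.comp_contDiffOn (contDiff_id.contDiffOn.prodMk hψ)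
  refine ⟨⟨ρ, min r R, ψ, fun q ↦ jetEnergy G (bvpJet _ (q, ψ q)), lt_min hr hR,
    (min_le_left _ _).trans_lt hrρ, hψ, fun q hq t ↦ hR't (hcurve q hq t), hgeo, ?_, ?_, ?_, ?_⟩⟩
  · intro u u' hu t
    have h := huniq u u' (fun t ht ↦ ?_) t
    · rw [bvpJet_apply] at h
      exact ⟨congrArg Prod.fst h, congrArg Prod.snd h⟩
    · obtain ⟨h1, h2, h3, h4⟩ := hu t ht
      refine ⟨ball_subset_ball (min_le_left _ _) h1, ball_subset_ball (min_le_left _ _) h2, h3, ?_⟩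
      rwa [hQeq]
      rw [mem_ball, Prod.dist_eq]
      exact max_lt (lt_of_lt_of_le h1 (min_le_right _ _)) (lt_of_lt_of_le h2 (min_le_right _ _))
  · exact (contDiff_jetEnergy G hG).comp_contDiffOn hψjet
  · intro q hq δ
    have e1 : G q.2 = chartMetric g p q.2 := hGeq (bvpCurve_one (q, ψ q) ▸ hcurve q hq 1)
    have e0 : G q.1 = chartMetric g p q.1 := hGeq (bvpCurve_zero (q, ψ q) ▸ hcurve q hq 0)
    rw [← e1, ← e0]
    refine fderiv_jetEnergy_bvpJet G hG ((hψ.contDiffAt (hN.mem_nhds hq)).differentiableAt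
      (by simp)) (fun t v w ↦ ?_) (fun t z ↦ ?_) δ
    · rw [hGeq (hcurve q hq t)]
      exact chartMetric_symm g p _ v w
    · rw [hgeo q hq t, hG1 _ (hcurve q hq t), hGeq (hcurve q hq t), map_neg,
        chartMetric_christoffel g (hR't (hcurve q hq t)), neg_apply,
        christoffelFirst_self_apply]
      ring
  · intro q hq c hc
    have h1 : superpose (energyDensity G) (bvpJet _ (q, ψ q)) = constL ℝ (c / 2) := by
      ext t
      change 1 / 2 * G (bvpJet _ (q, ψ q) t).1 (bvpJet _ (q, ψ q) t).2 (bvpJet _ (q, ψ q) t).2 = _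
      rw [bvpJet_apply, hGeq (hcurve q hq t), hc t, constL_apply]
      ring
    simp [jetEnergy, h1, primitive_apply, extend]

end Geodesic

/-! ### Geodesics of bounded speed -/

theorem eventually_norm_sub_lt {X W : Type*} [TopologicalSpace X] [SeminormedAddCommGroup W]
    {f : X → W} {a : X} (hf : ContinuousAt f a) {ε : ℝ} (hε : 0 < ε) :
    ∀ᶠ y in 𝓝 a, ‖f y - f a‖ < ε := by
  filter_upwards [hf.eventually (ball_mem_nhds _ hε)] with y hy
  exact mem_ball_iff_norm.1 hy

section Escape

variable {n : ℕ} {M : Type*} [TopologicalSpace M] [ChartedSpace (EuclideanSpace ℝ (Fin n)) M]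
  [IsManifold (𝓡 n) ∞ M]

/-- Near a point, the metric in a chart is bounded below by a multiple of the Euclidean metric. -/
theorem exists_le_chartMetric (g : RiemannianMetric n M) {p : M} {y₀ : EuclideanSpace ℝ (Fin n)}
    (hy₀ : y₀ ∈ (extChartAt (𝓡 n) p).target) :
    ∃ r > 0, ∃ c > 0, ball y₀ r ⊆ (extChartAt (𝓡 n) p).target ∧
      ∀ y ∈ ball y₀ r, ∀ v, c * ‖v‖ ^ 2 ≤ chartMetric g p y v v := by
  obtain ⟨m, hm, hmin⟩ : ∃ m > 0, ∀ v ∈ sphere (0 : EuclideanSpace ℝ (Fin n)) 1,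
      m ≤ chartMetric g p y₀ v v := by
    rcases (sphere (0 : EuclideanSpace ℝ (Fin n)) 1).eq_empty_or_nonempty with he | hne
    · exact ⟨1, one_pos, by simp [he]⟩
    · have hc : Continuous fun v ↦ chartMetric g p y₀ v v := by fun_prop
      obtain ⟨v, hv, hmin⟩ := (isCompact_sphere (0 : EuclideanSpace ℝ (Fin n)) 1).exists_isMinOn
        hne hc.continuousOn
      exact ⟨_, chartMetric_pos g hy₀ (ne_zero_of_mem_unit_sphere ⟨v, hv⟩), fun w hw ↦ hmin hw⟩
  have hcont : ContinuousAt (chartMetric g p) y₀ :=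
    (contDiffOn_chartMetric g p).continuousOn.continuousAt
      ((isOpen_extChartAt_target p).mem_nhds hy₀)
  have hev : ∀ᶠ y in 𝓝 y₀, ‖chartMetric g p y - chartMetric g p y₀‖ < m / 2 ∧
      y ∈ (extChartAt (𝓡 n) p).target := by
    refine Filter.Eventually.and ?_ ((isOpen_extChartAt_target p).mem_nhds hy₀)
    exact eventually_norm_sub_lt
      (W := EuclideanSpace ℝ (Fin n) →L[ℝ] EuclideanSpace ℝ (Fin n) →L[ℝ] ℝ) hcont (half_pos hm)
  obtain ⟨r, hr, hball⟩ := Metric.eventually_nhds_iff_ball.1 hev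
  refine ⟨r, hr, m / 2, by positivity, fun y hy ↦ (hball y hy).2, fun y hy v ↦ ?_⟩
  have h1 : m * ‖v‖ ^ 2 ≤ chartMetric g p y₀ v v := by
    rcases eq_or_ne v 0 with rfl | hv
    · simp
    · have h2 := hmin (‖v‖⁻¹ • v) (by simp [norm_smul, hv])
      have h3 : ‖v‖ ≠ 0 := norm_ne_zero_iff.2 hv
      simp only [map_smul, smul_apply, smul_eq_mul] at h2
      field_simp at h2
      exact h2
  have h2 : ‖(chartMetric g p y - chartMetric g p y₀) v v‖ ≤ m / 2 * ‖v‖ ^ 2 := by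
    refine (ContinuousLinearMap.le_opNorm₂ _ v v).trans ?_
    have := (hball y hy).1.le
    calc _ = ‖chartMetric g p y - chartMetric g p y₀‖ * ‖v‖ ^ 2 := by ring
      _ ≤ _ := by gcongr
  have h3 := neg_le_of_abs_le (Real.norm_eq_abs _ ▸ h2)
  simp only [sub_apply] at h3
  linarith

/-- A geodesic of bounded speed stays near its starting point for a definite time. -/
theorem exists_forall_mem_ball [T2Space M] (g : RiemannianMetric n M) {p : M}
    {y₀ : EuclideanSpace ℝ (Fin n)} (hy₀ : y₀ ∈ (extChartAt (𝓡 n) p).target) {r : ℝ} (hr : 0 < r)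
    {L : ℝ} (hL : 0 ≤ L) :
    ∃ r' > 0, ∃ δ > 0, ∃ C ≥ 0, ∀ x : C(UnitAddCircle, M), IsPeriodicGeodesic g x →
      loopLength g x ≤ L → ∀ t₀, toCurve x t₀ ∈ (extChartAt (𝓡 n) p).source →
      chartCurve p (toCurve x) t₀ ∈ ball y₀ r' → ∀ t, |t - t₀| ≤ δ →
        toCurve x t ∈ (extChartAt (𝓡 n) p).source ∧ chartCurve p (toCurve x) t ∈ ball y₀ r ∧
          ‖deriv (chartCurve (n := n) p (toCurve x)) t‖ ≤ C := by
  obtain ⟨r₁, hr₁, c, hc, hball, hlow⟩ := exists_le_chartMetric g hy₀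
  set ρ := min r r₁ with hρ
  have hρpos : 0 < ρ := lt_min hr hr₁
  let χ : ContDiffBump y₀ := ⟨ρ / 4, ρ / 2, by positivity, by linarith⟩
  have hout : closedBall y₀ (ρ / 2) ⊆ ball y₀ ρ := closedBall_subset_ball (by linarith)
  obtain ⟨B, hB⟩ : ∃ B, ∀ y, ‖fderiv ℝ χ y‖ ≤ B :=
    (χ.contDiff (n := 1)).continuous_fderiv (by simp) |>.bounded_above_of_compact_support
      (χ.hasCompactSupport.fderiv (𝕜 := ℝ))
  have hB0 : 0 ≤ B := (norm_nonneg _).trans (hB y₀)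
  set C := L / Real.sqrt c with hC
  have hC0 : 0 ≤ C := by positivity
  set K := (extChartAt (𝓡 n) p).symm '' closedBall y₀ (ρ / 2) with hK
  have htar : closedBall y₀ (ρ / 2) ⊆ (extChartAt (𝓡 n) p).target :=
    hout.trans ((ball_subset_ball (min_le_right _ _)).trans hball)
  have hKc : IsClosed K := ((isCompact_closedBall y₀ (ρ / 2)).image_of_continuousOn
    ((continuousOn_extChartAt_symm p).mono htar)).isClosed
  have hKmem : ∀ {q}, q ∈ K → q ∈ (extChartAt (𝓡 n) p).source ∧
      extChartAt (𝓡 n) p q ∈ closedBall y₀ (ρ / 2) := by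
    rintro _ ⟨y, hy, rfl⟩
    refine ⟨(extChartAt (𝓡 n) p).map_target (htar hy), ?_⟩
    rwa [(extChartAt (𝓡 n) p).right_inv (htar hy)]
  refine ⟨ρ / 4, by positivity, 1 / (2 * (B * C + 1)), by positivity, C, hC0, ?_⟩
  intro x hx hxL t₀ ht₀ hbt₀
  have hvel : ∀ t, toCurve x t ∈ (extChartAt (𝓡 n) p).source →
      chartCurve p (toCurve x) t ∈ ball y₀ ρ → ‖deriv (chartCurve (n := n) p (toCurve x)) t‖ ≤ C := by
    intro t hs hb
    have h1 := hlow _ (ball_subset_ball (min_le_right _ _) hb) (deriv (chartCurve p (toCurve x)) t)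
    rw [chartMetric_deriv_chartCurve g hx.1 hs, hx.speedSq_eq_loopLength_sq] at h1
    have hl0 : 0 ≤ loopLength g x := by rw [hx.loopLength_eq 0]; positivity
    rw [hC, le_div_iff₀ (by positivity)]
    refine abs_le_of_sq_le_sq' ?_ hL |>.2
    rw [mul_pow, Real.sq_sqrt hc.le]
    calc _ = c * ‖deriv (chartCurve p (toCurve x)) t‖ ^ 2 := by ring
      _ ≤ _ := h1
      _ ≤ _ := by gcongr
  classical
  -- A bump function around `y₀`, evaluated along the geodesic and extended by zero outside the chart,
  -- is Lipschitz. It starts at `1`, so it stays positive for a definite time.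
  let h : ℝ → ℝ := fun t ↦ if toCurve x t ∈ (extChartAt (𝓡 n) p).source then
    χ (chartCurve p (toCurve x) t) else 0
  have hder : ∀ t, ∃ d, HasDerivAt h d t ∧ ‖d‖ ≤ B * C := by
    intro t
    by_cases hk : toCurve x t ∈ K
    · obtain ⟨hs, hb⟩ := hKmem hk
      have h1 : HasDerivAt (χ ∘ chartCurve p (toCurve x)) _ t :=
        HasFDerivAt.comp_hasDerivAt (l := χ) (f := chartCurve p (toCurve x)) t
          ((χ.contDiff (n := 1)).differentiable (by simp) _).hasFDerivAt
          (hasDerivAt_chartCurve hx.1 hs)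
      refine ⟨_, h1.congr_of_eventuallyEq ?_, ?_⟩
      · filter_upwards [hx.1.continuous.continuousAt.eventually
          ((isOpen_extChartAt_source p).mem_nhds hs)] with s hs
        exact if_pos hs
      · refine (ContinuousLinearMap.le_opNorm _ _).trans ?_
        gcongr
        · exact hB _
        · exact hvel t hs (hout hb)
    · refine ⟨0, (hasDerivAt_const t (0 : ℝ)).congr_of_eventuallyEq ?_, by simpa using by positivity⟩
      filter_upwards [hx.1.continuous.continuousAt.eventually
        (hKc.isOpen_compl.mem_nhds hk)] with s hs
      by_cases hss : toCurve x s ∈ (extChartAt (𝓡 n) p).source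
      · have : chartCurve p (toCurve x) s ∉ closedBall y₀ (ρ / 2) := fun hb ↦
          hs ⟨_, hb, (extChartAt (𝓡 n) p).left_inv hss⟩
        change (if _ then _ else _) = (0 : ℝ)
        rw [if_pos hss]
        refine χ.zero_of_le_dist ?_
        rw [mem_closedBall, not_le] at this
        exact this.le
      · exact if_neg hss
  choose d hd hdB using hder
  intro t ht
  have hlip := Convex.norm_image_sub_le_of_norm_hasDerivWithin_le (s := univ) (f := h) (f' := d)
    (C := B * C) (fun t _ ↦ (hd t).hasDerivWithinAt) (fun t _ ↦ hdB t) convex_univ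
    (mem_univ t₀) (mem_univ t)
  have h0 : h t₀ = 1 := by
    change (if _ then _ else _) = (1 : ℝ)
    rw [if_pos ht₀]
    exact χ.one_of_mem_closedBall (ball_subset_closedBall hbt₀)
  have hpos : 0 < h t := by
    have h1 : B * C * ‖t - t₀‖ ≤ 1 / 2 := by
      calc B * C * ‖t - t₀‖ ≤ (B * C + 1) * (1 / (2 * (B * C + 1))) := by
            gcongr
            · linarith
            · exact ht
        _ = 1 / 2 := by field_simp
    have h2 := (abs_le.1 (hlip.trans h1)).1
    rw [h0] at h2
    linarith
  have hs : toCurve x t ∈ (extChartAt (𝓡 n) p).source := by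
    by_contra hs
    have : h t = 0 := if_neg hs
    exact hpos.ne' this
  have hb : chartCurve p (toCurve x) t ∈ ball y₀ ρ := by
    have h1 : h t = χ (chartCurve p (toCurve x) t) := if_pos hs
    rw [h1] at hpos
    have : chartCurve p (toCurve x) t ∈ Function.support χ := hpos.ne'
    rw [χ.support_eq] at this
    exact ball_subset_ball (by change ρ / 2 ≤ ρ; linarith) this
  exact ⟨hs, ball_subset_ball (min_le_left _ _) hb, hvel t hs hb⟩

/-- The arc of the curve `γ` over the time interval `[a, a + h]`, reparametrized to `[0, 1]`,
belongs to the family `F`. -/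
def GeodesicFamily.HasArc {g : RiemannianMetric n M} {p : M} {y₀ : EuclideanSpace ℝ (Fin n)}
    (F : GeodesicFamily g p y₀) (γ : ℝ → M) (a h : ℝ) : Prop :=
  ∀ t : unitInterval, γ (a + h * t) ∈ (extChartAt (𝓡 n) p).source ∧
    chartCurve p γ (a + h * t) ∈ ball y₀ F.r ∧
    bvpCurve _ ((chartCurve p γ a, chartCurve p γ (a + h)),
      F.accel (chartCurve p γ a, chartCurve p γ (a + h))) t = chartCurve p γ (a + h * t) ∧
    bvpVelocity _ ((chartCurve p γ a, chartCurve p γ (a + h)),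
      F.accel (chartCurve p γ a, chartCurve p γ (a + h))) t =
        h • deriv (chartCurve p γ) (a + h * t)

/-- The arcs over short time intervals of a periodic geodesic of length at most `L` belong to the
family, when they start near its centre. -/
theorem GeodesicFamily.exists_hasArc [T2Space M] {g : RiemannianMetric n M} {p : M}
    {y₀ : EuclideanSpace ℝ (Fin n)} (F : GeodesicFamily g p y₀)
    (hy₀ : y₀ ∈ (extChartAt (𝓡 n) p).target) {L : ℝ} (hL : 0 ≤ L) :
    ∃ r' > 0, ∃ δ > 0, ∀ x : C(UnitAddCircle, M), IsPeriodicGeodesic g x →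
      loopLength g x ≤ L → ∀ t₀, toCurve x t₀ ∈ (extChartAt (𝓡 n) p).source →
      chartCurve p (toCurve x) t₀ ∈ ball y₀ r' → ∀ a h, 0 ≤ h → |a - t₀| ≤ δ → |a + h - t₀| ≤ δ →
        F.HasArc (toCurve x) a h := by
  obtain ⟨r', hr', δ, hδ, C, hC, H⟩ := exists_forall_mem_ball g hy₀ F.r_pos hL
  have hr := F.r_pos
  refine ⟨r', hr', min δ (F.r / (4 * (C + 1))), lt_min hδ (by positivity), ?_⟩
  intro x hx hxL t₀ ht₀ hb a h hh ha hah
  have hmem : ∀ t ∈ Icc (0 : ℝ) 1, |a + h * t - t₀| ≤ δ := by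
    intro t ht
    rw [abs_le] at *
    have h1 : h * t ≤ h := mul_le_of_le_one_right hh ht.2
    have h2 : 0 ≤ h * t := mul_nonneg hh ht.1
    have h3 := min_le_left δ (F.r / (4 * (C + 1)))
    constructor <;> linarith [ha.1, hah.2]
  have hhC : h * C < F.r := by
    rw [abs_le] at ha hah
    have h3 := min_le_right δ (F.r / (4 * (C + 1)))
    have h4 : h ≤ 2 * (F.r / (4 * (C + 1))) := by linarith [ha.1, hah.2]
    calc h * C ≤ 2 * (F.r / (4 * (C + 1))) * (C + 1) := by gcongr; linarith
      _ = F.r / 2 := by field_simp; norm_num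
      _ < F.r := by linarith
  have hu := F.unique (fun t ↦ chartCurve p (toCurve x) (a + h * t))
    (fun t ↦ h • deriv (chartCurve p (toCurve x)) (a + h * t)) (fun t ht ↦ by
      obtain ⟨h1, h2, h3⟩ := H x hx hxL t₀ ht₀ hb _ (hmem t ht)
      have hlin : HasDerivAt (fun t ↦ a + h * t) h t := by
        simpa using ((hasDerivAt_id t).const_mul h).const_add a
      refine ⟨h2, ?_, ?_, ?_⟩
      · rw [mem_ball_zero_iff, norm_smul, Real.norm_of_nonneg hh]
        exact lt_of_le_of_lt (by gcongr) hhC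
      · exact (hasDerivAt_chartCurve hx.1 h1).scomp t hlin
      · have h4 := ((hx.hasDerivAt_deriv_chartCurve h1).scomp t hlin).const_smul h
        refine h4.congr_deriv ?_
        rw [christoffel_smul_smul, smul_neg, smul_neg, smul_smul, pow_two])
  intro t
  obtain ⟨h1, h2, h3⟩ := H x hx hxL t₀ ht₀ hb _ (hmem t t.2)
  have := hu t
  simp only [mul_zero, add_zero, mul_one] at this
  exact ⟨h1, h2, this.1, this.2⟩

end Escape

/-! ### Limits of periodic geodesics -/

section Limit

variable {n : ℕ} {M : Type*} [TopologicalSpace M] [ChartedSpace (EuclideanSpace ℝ (Fin n)) M]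
  [IsManifold (𝓡 n) ∞ M]

theorem GeodesicFamily.ball_subset_target {g : RiemannianMetric n M} {p : M}
    {y₀ : EuclideanSpace ℝ (Fin n)} (F : GeodesicFamily g p y₀) :
    ball y₀ F.radius ⊆ (extChartAt (𝓡 n) p).target := by
  intro y hy
  have := F.mem_target (y, y) ⟨hy, hy⟩ 0
  rwa [bvpCurve_zero] at this

theorem GeodesicFamily.closedBall_subset_ball {g : RiemannianMetric n M} {p : M}
    {y₀ : EuclideanSpace ℝ (Fin n)} (F : GeodesicFamily g p y₀) :
    closedBall y₀ F.r ⊆ ball y₀ F.radius :=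
  Metric.closedBall_subset_ball F.r_lt

/-- Position and velocity of the arcs of the family depend continuously on the end points. -/
theorem GeodesicFamily.continuousAt_bvpJet {g : RiemannianMetric n M} {p : M}
    {y₀ : EuclideanSpace ℝ (Fin n)} (F : GeodesicFamily g p y₀)
    {q : EuclideanSpace ℝ (Fin n) × EuclideanSpace ℝ (Fin n)}
    (hq : q ∈ ball y₀ F.radius ×ˢ ball y₀ F.radius) :
    ContinuousAt (fun q ↦ bvpCurve _ (q, F.accel q)) q ∧
      ContinuousAt (fun q ↦ bvpVelocity _ (q, F.accel q)) q := by
  have h1 : ContinuousAt (fun q ↦ (q, F.accel q)) q := continuousAt_id.prodMk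
    (F.contDiffOn_accel.continuousOn.continuousAt ((isOpen_ball.prod isOpen_ball).mem_nhds hq))
  exact ⟨(bvpCurve (EuclideanSpace ℝ (Fin n))).continuous.continuousAt.comp h1,
    (bvpVelocity (EuclideanSpace ℝ (Fin n))).continuous.continuousAt.comp h1⟩

omit [IsManifold (𝓡 n) ∞ M] in
/-- If points with coordinates in a compact part of the chart converge in `M` along an ultrafilter,
then the limit lies in the chart and the coordinates converge. -/
theorem tendsto_chart_of_mem_closedBall [T2Space M] {ι : Type*} {𝒰 : Ultrafilter ι} {q : ι → M}
    {q₀ p : M} {y₀ : EuclideanSpace ℝ (Fin n)} {r : ℝ} (hq : Tendsto q 𝒰 (𝓝 q₀))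
    (hr : closedBall y₀ r ⊆ (extChartAt (𝓡 n) p).target)
    (hmem : ∀ᶠ i in 𝒰, q i ∈ (extChartAt (𝓡 n) p).source ∧
      extChartAt (𝓡 n) p (q i) ∈ closedBall y₀ r) :
    q₀ ∈ (extChartAt (𝓡 n) p).source ∧ extChartAt (𝓡 n) p q₀ ∈ closedBall y₀ r ∧
      Tendsto (fun i ↦ extChartAt (𝓡 n) p (q i)) 𝒰 (𝓝 (extChartAt (𝓡 n) p q₀)) := by
  obtain ⟨c, hc, hlim⟩ := (isCompact_closedBall y₀ r).ultrafilter_le_nhds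
    (𝒰.map fun i ↦ extChartAt (𝓡 n) p (q i)) (by
      rw [le_principal_iff]
      exact hmem.mono fun i hi ↦ hi.2)
  have hlim' : Tendsto (fun i ↦ extChartAt (𝓡 n) p (q i)) 𝒰 (𝓝 c) := hlim
  have h1 : Tendsto (fun i ↦ (extChartAt (𝓡 n) p).symm (extChartAt (𝓡 n) p (q i))) 𝒰
      (𝓝 ((extChartAt (𝓡 n) p).symm c)) :=
    ((continuousOn_extChartAt_symm p).continuousAt
      ((isOpen_extChartAt_target p).mem_nhds (hr hc))).tendsto.comp hlim'
  have h2 : Tendsto q 𝒰 (𝓝 ((extChartAt (𝓡 n) p).symm c)) := by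
    refine h1.congr' ?_
    filter_upwards [hmem] with i hi
    exact (extChartAt (𝓡 n) p).left_inv hi.1
  have h3 := tendsto_nhds_unique hq h2
  have h4 : extChartAt (𝓡 n) p q₀ = c := by rw [h3, (extChartAt (𝓡 n) p).right_inv (hr hc)]
  refine ⟨?_, h4 ▸ hc, h4 ▸ hlim'⟩
  rw [h3]
  exact (extChartAt (𝓡 n) p).map_target (hr hc)

/-- A pointwise limit of periodic geodesics of bounded length satisfies the geodesic equation in
every chart, and the velocities converge. -/
theorem exists_forall_hasDerivAt_of_tendsto [T2Space M] {g : RiemannianMetric n M} {ι : Type*}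
    {𝒰 : Ultrafilter ι} {x : ι → C(UnitAddCircle, M)} {L : ℝ} (hL : 0 ≤ L)
    (hx : ∀ᶠ i in 𝒰, IsPeriodicGeodesic g (x i) ∧ loopLength g (x i) ≤ L) {y : ℝ → M}
    (hy : ∀ t, Tendsto (fun i ↦ toCurve (x i) t) 𝒰 (𝓝 (y t))) {p : M} {t₀ : ℝ}
    (ht₀ : y t₀ ∈ (extChartAt (𝓡 n) p).source) :
    ∃ δ > 0, ∀ t ∈ Ioo (t₀ - δ) (t₀ + δ), y t ∈ (extChartAt (𝓡 n) p).source ∧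
      HasDerivAt (chartCurve (n := n) p y) (deriv (chartCurve p y) t) t ∧
      HasDerivAt (deriv (chartCurve (n := n) p y)) (-christoffel g p (chartCurve p y t)
        (deriv (chartCurve p y) t) (deriv (chartCurve p y) t)) t ∧
      Tendsto (fun i ↦ deriv (chartCurve (n := n) p (toCurve (x i))) t) 𝒰
        (𝓝 (deriv (chartCurve (n := n) p y) t)) := by
  set y₀ := extChartAt (𝓡 n) p (y t₀) with hy₀
  have hy₀t : y₀ ∈ (extChartAt (𝓡 n) p).target := (extChartAt (𝓡 n) p).map_source ht₀
  obtain ⟨F⟩ := nonempty_geodesicFamily g p hy₀t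
  obtain ⟨r', hr', δ, hδ, H⟩ := F.exists_hasArc hy₀t hL
  have hsrc : (extChartAt (𝓡 n) p).source ∩ extChartAt (𝓡 n) p ⁻¹' ball y₀ r' ∈ 𝓝 (y t₀) :=
    (continuousOn_extChartAt p).isOpen_inter_preimage (isOpen_extChartAt_source p) isOpen_ball
      |>.mem_nhds ⟨ht₀, mem_ball_self hr'⟩
  -- near time `t₀` the geodesics are arcs of one family over the same time interval `[a, a + h]`, and
  -- these depend continuously on their end points
  set a := t₀ - δ with ha
  set h := 2 * δ with hh
  have hhpos : 0 < h := by positivity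
  have harc : ∀ᶠ i in 𝒰, F.HasArc (toCurve (x i)) a h := by
    filter_upwards [hx, (hy t₀).eventually hsrc] with i hi hi'
    refine H (x i) hi.1 hi.2 t₀ hi'.1 hi'.2 a h hhpos.le ?_ ?_
    · rw [ha, sub_sub_cancel_left, abs_neg, abs_of_pos hδ]
    · rw [ha, hh, show t₀ - δ + 2 * δ - t₀ = δ by ring, abs_of_pos hδ]
  have hlim : ∀ t : unitInterval, y (a + h * t) ∈ (extChartAt (𝓡 n) p).source ∧
      chartCurve p y (a + h * t) ∈ closedBall y₀ F.r ∧
      Tendsto (fun i ↦ chartCurve (n := n) p (toCurve (x i)) (a + h * t)) 𝒰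
        (𝓝 (chartCurve p y (a + h * t))) := fun t ↦
    tendsto_chart_of_mem_closedBall (hy (a + h * t))
      (F.closedBall_subset_ball.trans F.ball_subset_target)
      (harc.mono fun i hi ↦ ⟨(hi t).1, ball_subset_closedBall (hi t).2.1⟩)
  set q := (chartCurve (n := n) p y a, chartCurve (n := n) p y (a + h)) with hq
  have h0 := hlim 0
  have h1 := hlim 1
  rw [show a + h * ((0 : unitInterval) : ℝ) = a by simp] at h0
  rw [show a + h * ((1 : unitInterval) : ℝ) = a + h by simp] at h1
  have hqN : q ∈ ball y₀ F.radius ×ˢ ball y₀ F.radius :=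
    ⟨F.closedBall_subset_ball h0.2.1, F.closedBall_subset_ball h1.2.1⟩
  have hqlim : Tendsto (fun i ↦ (chartCurve (n := n) p (toCurve (x i)) a,
      chartCurve (n := n) p (toCurve (x i)) (a + h))) 𝒰 (𝓝 q) := h0.2.2.prodMk_nhds h1.2.2
  obtain ⟨hc, hv⟩ := F.continuousAt_bvpJet hqN
  set Z := (q, F.accel q) with hZ
  have hcurve : ∀ t : unitInterval, chartCurve p y (a + h * t) = bvpCurve _ Z t := by
    intro t
    have h2 := ((continuous_eval_const t).tendsto _).comp (hc.tendsto.comp hqlim)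
    refine tendsto_nhds_unique (hlim t).2.2 (h2.congr' ?_)
    filter_upwards [harc] with i hi
    exact (hi t).2.2.1
  have hvel : ∀ t : unitInterval, Tendsto (fun i ↦ deriv (chartCurve (n := n) p (toCurve (x i)))
      (a + h * t)) 𝒰 (𝓝 (h⁻¹ • bvpVelocity _ Z t)) := by
    intro t
    have h2 := (((continuous_eval_const t).tendsto _).comp
      (hv.tendsto.comp hqlim)).const_smul h⁻¹
    refine h2.congr' ?_
    filter_upwards [harc] with i hi
    simp only [Function.comp_apply]
    rw [(hi t).2.2.2, smul_smul, inv_mul_cancel₀ hhpos.ne', one_smul]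
  let σ : ℝ → ℝ := fun s ↦ (s - a) / h
  have hσ : ∀ s, HasDerivAt σ h⁻¹ s := fun s ↦ by
    simpa [σ, div_eq_mul_inv] using ((hasDerivAt_id s).sub_const a).mul_const h⁻¹
  have hσmem : ∀ s ∈ Ioo (t₀ - δ) (t₀ + δ), σ s ∈ Ioo (0 : ℝ) 1 := by
    intro s hs
    refine ⟨div_pos (by linarith [hs.1]) hhpos, (div_lt_one hhpos).2 (by linarith [hs.2])⟩
  have hσs : ∀ s, a + h * σ s = s := fun s ↦ by simp only [σ]; field_simp; ring
  have hu : ∀ s ∈ Ioo (t₀ - δ) (t₀ + δ),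
      chartCurve p y s = extend (bvpCurve (EuclideanSpace ℝ (Fin n)) Z) (σ s) := by
    intro s hs
    have hI : σ s ∈ Icc (0 : ℝ) 1 := Ioo_subset_Icc_self (hσmem s hs)
    rw [extend_of_mem _ hI, ← hcurve ⟨σ s, hI⟩]
    simp only [hσs]
  have hd1 : ∀ s ∈ Ioo (t₀ - δ) (t₀ + δ), HasDerivAt (chartCurve (n := n) p y)
      (h⁻¹ • extend (bvpVelocity (EuclideanSpace ℝ (Fin n)) Z) (σ s)) s := by
    intro s hs
    refine ((hasDerivAt_extend_bvpCurve Z (hσmem s hs)).scomp s (hσ s)).congr_of_eventuallyEq ?_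
    filter_upwards [isOpen_Ioo.mem_nhds hs] with s' hs' using hu s' hs'
  have hd2 : ∀ s ∈ Ioo (t₀ - δ) (t₀ + δ), HasDerivAt (deriv (chartCurve (n := n) p y))
      (h⁻¹ • h⁻¹ • extend (F.accel q) (σ s)) s := by
    intro s hs
    refine (((hasDerivAt_extend_bvpVelocity Z (hσmem s hs)).scomp s
      (hσ s)).const_smul h⁻¹).congr_of_eventuallyEq ?_
    filter_upwards [isOpen_Ioo.mem_nhds hs] with s' hs' using (hd1 s' hs').deriv
  refine ⟨δ, hδ, fun t ht ↦ ?_⟩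
  have hI : σ t ∈ Icc (0 : ℝ) 1 := Ioo_subset_Icc_self (hσmem t ht)
  have ht' : a + h * ((⟨σ t, hI⟩ : unitInterval) : ℝ) = t := hσs t
  refine ⟨?_, ?_, ?_, ?_⟩
  · have := (hlim ⟨σ t, hI⟩).1
    rwa [ht'] at this
  · rw [(hd1 t ht).deriv]; exact hd1 t ht
  · refine (hd2 t ht).congr_deriv ?_
    rw [(hd1 t ht).deriv, christoffel_smul_smul, hu t ht, extend_of_mem _ hI, extend_of_mem _ hI,
      extend_of_mem _ hI, F.geodesic q hqN, smul_smul, smul_neg, pow_two]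
  · have := hvel ⟨σ t, hI⟩
    rw [ht'] at this
    rw [(hd1 t ht).deriv, extend_of_mem _ hI]
    exact this

/-- Solutions of the geodesic equation in a chart are smooth. -/
theorem contDiffAt_of_geodesic_equation {g : RiemannianMetric n M} {p : M}
    {u : ℝ → EuclideanSpace ℝ (Fin n)} {t₀ δ : ℝ} (hδ : 0 < δ)
    (hu : ∀ t ∈ Ioo (t₀ - δ) (t₀ + δ), u t ∈ (extChartAt (𝓡 n) p).target ∧
      HasDerivAt u (deriv u t) t ∧
      HasDerivAt (deriv u) (-christoffel g p (u t) (deriv u t) (deriv u t)) t) :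
    ContDiffAt ℝ ∞ u t₀ := by
  have hsub : Icc (t₀ - δ / 2) (t₀ + δ / 2) ⊆ Ioo (t₀ - δ) (t₀ + δ) :=
    fun t ht ↦ ⟨by linarith [ht.1], by linarith [ht.2]⟩
  let f : ℝ → EuclideanSpace ℝ (Fin n) × EuclideanSpace ℝ (Fin n) →
    EuclideanSpace ℝ (Fin n) × EuclideanSpace ℝ (Fin n) :=
    fun _ z ↦ (z.2, -christoffel g p z.1 z.2 z.2)
  have hf : ContDiffOn ℝ ∞ (Function.uncurry f) (Icc (t₀ - δ / 2) (t₀ + δ / 2) ×ˢ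
      ((extChartAt (𝓡 n) p).target ×ˢ (univ : Set (EuclideanSpace ℝ (Fin n))))) := by
    have h1 : ContDiffOn ℝ ∞ (fun z : ℝ × EuclideanSpace ℝ (Fin n) × EuclideanSpace ℝ (Fin n) ↦
        christoffel g p z.2.1 z.2.2 z.2.2) (Icc (t₀ - δ / 2) (t₀ + δ / 2) ×ˢ
      ((extChartAt (𝓡 n) p).target ×ˢ (univ : Set (EuclideanSpace ℝ (Fin n))))) :=
      (contDiffOn_christoffel g p).comp contDiff_snd.contDiffOn fun z hz ↦ hz.2
    exact (contDiff_snd.comp contDiff_snd).contDiffOn.prodMk h1.neg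
  have h := ODE.contDiffOn_enat_Icc_of_hasDerivWithinAt (n := ⊤) (f := f)
    (α := fun t ↦ (u t, deriv u t)) (tmin := t₀ - δ / 2) (tmax := t₀ + δ / 2)
    (u := (extChartAt (𝓡 n) p).target ×ˢ (univ : Set (EuclideanSpace ℝ (Fin n)))) hf
    (fun t ht ↦ by
      obtain ⟨-, h2, h3⟩ := hu t (hsub ht)
      exact (h2.prodMk h3).hasDerivWithinAt)
    (fun t ht ↦ ⟨(hu t (hsub ht)).1, mem_univ _⟩)
  exact contDiff_fst.contDiffAt.comp t₀ (h.contDiffAt (Icc_mem_nhds (by linarith) (by linarith)))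

omit [ChartedSpace (EuclideanSpace ℝ (Fin n)) M] [IsManifold (𝓡 n) ∞ M] in
theorem toCurve_add_one (x : C(UnitAddCircle, M)) (t : ℝ) : toCurve x (t + 1) = toCurve x t := by
  simp [toCurve]

/-- The loop given by a continuous 1-periodic curve. -/
def loopOfPeriodic {X : Type*} [TopologicalSpace X] (y : ℝ → X) (hy : Continuous y)
    (hper : Function.Periodic y 1) : C(UnitAddCircle, X) where
  toFun := hper.lift
  continuous_toFun := continuous_quot_lift _ hy

/-- **Compactness of the space of periodic geodesics of bounded length.** Along an ultrafilter,
periodic geodesics of bounded length converge pointwise to a periodic geodesic, and their lengths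
converge as well. -/
theorem exists_tendsto_isPeriodicGeodesic [T2Space M] [CompactSpace M] {g : RiemannianMetric n M}
    {ι : Type*} {𝒰 : Ultrafilter ι} {x : ι → C(UnitAddCircle, M)} {L : ℝ} (hL : 0 ≤ L)
    (hx : ∀ᶠ i in 𝒰, IsPeriodicGeodesic g (x i) ∧ loopLength g (x i) ≤ L) :
    ∃ y : C(UnitAddCircle, M), IsPeriodicGeodesic g y ∧
      (∀ t, Tendsto (fun i ↦ toCurve (x i) t) 𝒰 (𝓝 (toCurve y t))) ∧
      Tendsto (fun i ↦ loopLength g (x i)) 𝒰 (𝓝 (loopLength g y)) := by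
  have hlim : ∀ t, ∃ y : M, Tendsto (fun i ↦ toCurve (x i) t) 𝒰 (𝓝 y) := by
    intro t
    obtain ⟨y, -, hy⟩ := isCompact_univ.ultrafilter_le_nhds
      (𝒰.map fun i ↦ toCurve (x i) t) (by simp)
    exact ⟨y, hy⟩
  choose y hy using hlim
  have hper : Function.Periodic y 1 := fun t ↦ by
    refine tendsto_nhds_unique (hy (t + 1)) ?_
    simpa only [toCurve_add_one] using hy t
  have hsm : ContMDiff 𝓘(ℝ, ℝ) (𝓡 n) ∞ y := by
    intro t₀
    have ht₀ : y t₀ ∈ (extChartAt (𝓡 n) (y t₀)).source := mem_extChartAt_source _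
    obtain ⟨δ, hδ, H⟩ := exists_forall_hasDerivAt_of_tendsto hL hx hy ht₀
    have h1 : ContDiffAt ℝ ∞ (chartCurve (n := n) (y t₀) y) t₀ :=
      contDiffAt_of_geodesic_equation (g := g) (p := y t₀) hδ fun t ht ↦
        ⟨(extChartAt (𝓡 n) (y t₀)).map_source (H t ht).1, (H t ht).2.1, (H t ht).2.2.1⟩
    have h2 : ContMDiffAt 𝓘(ℝ, EuclideanSpace ℝ (Fin n)) (𝓡 n) ∞ (extChartAt (𝓡 n) (y t₀)).symm
        (chartCurve (n := n) (y t₀) y t₀) :=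
      (contMDiffOn_extChartAt_symm (n := ∞) (y t₀)).contMDiffAt
        ((isOpen_extChartAt_target (y t₀)).mem_nhds ((extChartAt (𝓡 n) (y t₀)).map_source ht₀))
    refine (h2.comp t₀ h1.contMDiffAt).congr_of_eventuallyEq ?_
    filter_upwards [Ioo_mem_nhds (sub_lt_self t₀ hδ) (lt_add_of_pos_right t₀ hδ)] with t ht
    exact ((extChartAt (𝓡 n) (y t₀)).left_inv (H t ht).1).symm
  let Y : C(UnitAddCircle, M) := loopOfPeriodic y hsm.continuous hper
  have hY : toCurve Y = y := rfl
  have hgeo : IsPeriodicGeodesic g Y := by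
    refine ⟨hsm, fun p t ht ↦ ?_⟩
    obtain ⟨δ, hδ, H⟩ := exists_forall_hasDerivAt_of_tendsto hL hx hy ht
    obtain ⟨-, -, h3, -⟩ := H t ⟨by linarith, by linarith⟩
    have h4 : deriv (deriv (chartCurve (n := n) p y)) t + christoffel g p (chartCurve p y t)
      (deriv (chartCurve p y) t) (deriv (chartCurve p y) t) = 0 := by rw [h3.deriv, neg_add_cancel]
    exact h4
  refine ⟨Y, hgeo, hy, ?_⟩
  rw [hgeo.loopLength_eq 0]
  set p := y 0 with hp
  have h0 : y 0 ∈ (extChartAt (𝓡 n) p).source := mem_extChartAt_source _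
  obtain ⟨δ, hδ, H⟩ := exists_forall_hasDerivAt_of_tendsto hL hx hy h0
  obtain ⟨-, -, -, hv⟩ := H 0 ⟨by linarith, by linarith⟩
  have hc : Tendsto (fun i ↦ chartCurve (n := n) p (toCurve (x i)) 0) 𝒰
      (𝓝 (chartCurve p y 0)) :=
    (continuousAt_extChartAt p).tendsto.comp (hy 0)
  have hG : ContinuousAt (fun z : EuclideanSpace ℝ (Fin n) × EuclideanSpace ℝ (Fin n) ↦
      chartMetric g p z.1 z.2 z.2) (chartCurve p y 0, deriv (chartCurve (n := n) p y) 0) := by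
    have h1 : ContinuousAt (chartMetric g p) (chartCurve p y 0) :=
      (contDiffOn_chartMetric g p).continuousOn.continuousAt
        ((isOpen_extChartAt_target p).mem_nhds ((extChartAt (𝓡 n) p).map_source h0))
    have h2 := ContinuousAt.comp (f := Prod.fst) (g := chartMetric g p)
      (x := (chartCurve p y 0, deriv (chartCurve (n := n) p y) 0)) h1 continuousAt_fst
    exact (h2.clm_apply continuousAt_snd).clm_apply continuousAt_snd
  have h5 := (Real.continuous_sqrt.tendsto _).comp (hG.tendsto.comp (hc.prodMk_nhds hv))
  have h6 : chartMetric g p (chartCurve p y 0) (deriv (chartCurve p y) 0)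
      (deriv (chartCurve p y) 0) = speedSq g y 0 := chartMetric_deriv_chartCurve g hsm h0
  simp only [h6] at h5
  refine h5.congr' ?_
  filter_upwards [hx, (hy 0).eventually ((isOpen_extChartAt_source p).mem_nhds h0)] with i hi hi'
  rw [hi.1.loopLength_eq 0, ← chartMetric_deriv_chartCurve g hi.1.1 hi']
  rfl

end Limit

/-! ### Nearby periodic geodesics are homotopic -/

section Cover

variable {n : ℕ} {M : Type*} [TopologicalSpace M] [ChartedSpace (EuclideanSpace ℝ (Fin n)) M]
  [IsManifold (𝓡 n) ∞ M]

/-- A family of short geodesic arcs around the point `p`, in the chart at `p`. -/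
noncomputable def geodesicFamily (g : RiemannianMetric n M) (p : M) :
    GeodesicFamily g p (extChartAt (𝓡 n) p p) :=
  (nonempty_geodesicFamily g p (mem_extChartAt_target p)).some

/-- A finite set of charts and a number `k` such that every periodic geodesic of length at most `L`
is composed of `k` arcs which belong to the families of arcs in these charts. The chart only
depends on the starting point of the arc. -/
theorem exists_uniform_arcs [T2Space M] [CompactSpace M] (g : RiemannianMetric n M) {L : ℝ}
    (hL : 0 ≤ L) : ∃ (P : Finset M) (W : M → Set M) (c : M → M) (k : ℕ), 0 < k ∧
      (∀ p, IsOpen (W p)) ∧ (∀ q, c q ∈ P ∧ q ∈ W (c q)) ∧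
      ∀ x : C(UnitAddCircle, M), IsPeriodicGeodesic g x → loopLength g x ≤ L →
        ∀ p ∈ P, ∀ t, toCurve x t ∈ W p → (geodesicFamily g p).HasArc (toCurve x) t (1 / k) := by
  have H := fun p : M ↦ (geodesicFamily g p).exists_hasArc (mem_extChartAt_target p) hL
  choose r' hr' δ hδ H using H
  let W : M → Set M := fun p ↦ (extChartAt (𝓡 n) p).source ∩
    extChartAt (𝓡 n) p ⁻¹' ball (extChartAt (𝓡 n) p p) (r' p)
  have hW : ∀ p, IsOpen (W p) := fun p ↦
    (continuousOn_extChartAt p).isOpen_inter_preimage (isOpen_extChartAt_source p) isOpen_ball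
  obtain ⟨P, hP⟩ := isCompact_univ.elim_finite_subcover W hW
    (fun p _ ↦ mem_iUnion.2 ⟨p, mem_extChartAt_source p, mem_ball_self (hr' p)⟩)
  have hc : ∀ q, ∃ p, p ∈ P ∧ q ∈ W p := fun q ↦ by
    simpa using hP (mem_univ q)
  choose c hc using hc
  have hk : ∃ k : ℕ, 0 < k ∧ ∀ p ∈ P, 1 / (k : ℝ) ≤ δ p := by
    have : ∀ᶠ k : ℕ in atTop, ∀ p ∈ P, 1 / (k : ℝ) ≤ δ p := by
      rw [Finset.eventually_all]
      exact fun p _ ↦ (tendsto_one_div_atTop_nhds_zero_nat.eventually (gt_mem_nhds (hδ p))).mono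
        fun k hk ↦ hk.le
    obtain ⟨k, hk1, hk2⟩ := (this.and (eventually_gt_atTop 0)).exists
    exact ⟨k, hk2, hk1⟩
  obtain ⟨k, hk0, hk⟩ := hk
  refine ⟨P, W, c, k, hk0, hW, hc, fun x hx hxL p hp t ht ↦ ?_⟩
  refine H p x hx hxL t ht.1 ht.2 t (1 / k) (by positivity) ?_ ?_
  · simpa using (hδ p).le
  · rw [add_sub_cancel_left, abs_of_nonneg (by positivity)]
    exact hk p hp

end Cover

/-- Gluing of a sequence of continuous maps along the integers. -/
theorem continuous_floor_glue {X Y : Type*} [TopologicalSpace X] [TopologicalSpace Y]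
    {K : ℤ → X × ℝ → Y} (hK : ∀ j, Continuous (K j))
    (hglue : ∀ j x, K j (x, (j : ℝ) + 1) = K (j + 1) (x, (j : ℝ) + 1)) :
    Continuous fun z : X × ℝ ↦ K ⌊z.2⌋ z := by
  rw [continuous_iff_continuousAt]
  intro z
  set j := ⌊z.2⌋ with hj
  have hcont : Continuous fun z : X × ℝ ↦ if (j : ℝ) ≤ z.2 then K j z else K (j - 1) z := by
    refine Continuous.if_le (hK j) (hK (j - 1)) continuous_const continuous_snd ?_
    rintro ⟨x, t⟩ rfl
    have := hglue (j - 1) x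
    push_cast at this
    simpa using this.symm
  refine hcont.continuousAt.congr ?_
  have hmem : z.2 ∈ Ioo ((j : ℝ) - 1) (j + 1) :=
    ⟨by linarith [Int.floor_le z.2], Int.lt_floor_add_one z.2⟩
  filter_upwards [continuous_snd.continuousAt.eventually (isOpen_Ioo.mem_nhds hmem)] with w hw
  split_ifs with h
  · rw [Int.floor_eq_iff.2 ⟨h, hw.2⟩]
  · have : ⌊w.2⌋ = j - 1 := Int.floor_eq_iff.2 ⟨by push_cast; exact hw.1.le, by
      push_cast; linarith⟩
    rw [this]

/-- A homotopy of loops given by a continuous family of 1-periodic curves. -/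
theorem homotopic_of_periodic {X : Type*} [TopologicalSpace X] {x y : C(UnitAddCircle, X)}
    {H : unitInterval × ℝ → X} (hH : Continuous H) (hper : ∀ s t, H (s, t + 1) = H (s, t))
    (h0 : ∀ t, H (0, t) = toCurve x t) (h1 : ∀ t, H (1, t) = toCurve y t) :
    ContinuousMap.Homotopic x y := by
  have hp : ∀ s, Function.Periodic (fun t ↦ H (s, t)) 1 := fun s t ↦ hper s t
  let Φ : unitInterval × UnitAddCircle → X := fun z ↦ (hp z.1).lift z.2
  have hq : IsOpenQuotientMap (Prod.map id QuotientAddGroup.mk :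
      unitInterval × ℝ → unitInterval × UnitAddCircle) :=
    IsOpenQuotientMap.id.prodMap QuotientAddGroup.isOpenQuotientMap_mk
  have hΦ : Continuous Φ := hq.isQuotientMap.continuous_iff.2 hH
  refine ⟨⟨⟨Φ, hΦ⟩, fun θ ↦ ?_, fun θ ↦ ?_⟩⟩
  · induction θ using QuotientAddGroup.induction_on with
    | H t => exact h0 t
  · induction θ using QuotientAddGroup.induction_on with
    | H t => exact h1 t

section Homotopy

variable {n : ℕ} {M : Type*} [TopologicalSpace M] [ChartedSpace (EuclideanSpace ℝ (Fin n)) M]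
  [IsManifold (𝓡 n) ∞ M]

/-- The point at time `s` on the segment between `q` and `m` in the chart at `p`. -/
noncomputable def chartSegment (p q m : M) (s : ℝ) : EuclideanSpace ℝ (Fin n) :=
  AffineMap.lineMap (extChartAt (𝓡 n) p q) (extChartAt (𝓡 n) p m) s

omit [IsManifold (𝓡 n) ∞ M] in
/-- Segments in a chart between nearby points stay in a given neighbourhood. -/
theorem exists_nhds_chartSegment_mem {p q : M} (hq : q ∈ (extChartAt (𝓡 n) p).source)
    {V : Set M} (hV : V ∈ 𝓝 q) : ∃ N ∈ 𝓝 q, ∀ m ∈ N, ∀ s ∈ Icc (0 : ℝ) 1,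
      (extChartAt (𝓡 n) p).symm (chartSegment p q m s) ∈ V := by
  have hc : ContinuousAt (extChartAt (𝓡 n) p).symm (extChartAt (𝓡 n) p q) :=
    (continuousOn_extChartAt_symm p).continuousAt
      ((isOpen_extChartAt_target p).mem_nhds ((extChartAt (𝓡 n) p).map_source hq))
  have hV' : (extChartAt (𝓡 n) p).symm ⁻¹' V ∈ 𝓝 (extChartAt (𝓡 n) p q) := by
    refine hc.preimage_mem_nhds ?_
    rwa [(extChartAt (𝓡 n) p).left_inv hq]
  obtain ⟨ε, hε, hball⟩ := Metric.mem_nhds_iff.1 hV'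
  have hc' : ContinuousAt (extChartAt (𝓡 n) p) q :=
    (continuousOn_extChartAt p).continuousAt ((isOpen_extChartAt_source p).mem_nhds hq)
  refine ⟨_, hc'.preimage_mem_nhds (ball_mem_nhds _ hε), fun m hm s hs ↦ hball ?_⟩
  exact (convex_ball _ _).lineMap_mem (mem_ball_self hε) hm hs

/-- Two periodic geodesics which are composed of arcs in the same families are homotopic, if the
geodesic arcs between corresponding points of the segments joining their vertices exist. -/
theorem homotopic_of_hasArc {g : RiemannianMetric n M} {x y : C(UnitAddCircle, M)} {k : ℕ}
    (hk : 0 < k) {p : ℤ → M} (hp : ∀ j, p (j + k) = p j)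
    (hx : ∀ j : ℤ, (geodesicFamily g (p j)).HasArc (toCurve x) (j / k) (1 / k))
    (hy : ∀ j : ℤ, (geodesicFamily g (p j)).HasArc (toCurve y) (j / k) (1 / k))
    (hxy : ∀ j : ℤ, ∀ s ∈ Icc (0 : ℝ) 1,
      (extChartAt (𝓡 n) (p (j + 1))).symm (chartSegment (n := n) (p (j + 1))
        (toCurve y ((j + 1 : ℤ) / k)) (toCurve x ((j + 1 : ℤ) / k)) s) ∈
      (extChartAt (𝓡 n) (p j)).source ∩ extChartAt (𝓡 n) (p j) ⁻¹'
        ball (extChartAt (𝓡 n) (p j) (p j)) (geodesicFamily g (p j)).radius) :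
    ContinuousMap.Homotopic y x := by
  have hk' : (k : ℝ) ≠ 0 := by exact_mod_cast hk.ne'
  -- `A j s` is the vertex number `j` of the loop at time `s` in the chart at `p j`, `q j s` are the end
  -- points of its arc number `j`, and `K j` is the homotopy of these arcs, on the time interval
  -- `[j, j + 1]`
  let A : ℤ → unitInterval → EuclideanSpace ℝ (Fin n) := fun j s ↦
    chartSegment (p j) (toCurve y (j / k)) (toCurve x (j / k)) s
  let m : ℤ → unitInterval → M := fun j s ↦ (extChartAt (𝓡 n) (p j)).symm (A j s)
  let q : ℤ → unitInterval → EuclideanSpace ℝ (Fin n) × EuclideanSpace ℝ (Fin n) :=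
    fun j s ↦ (A j s, extChartAt (𝓡 n) (p j) (m (j + 1) s))
  let F : ∀ j, GeodesicFamily g (p j) (extChartAt (𝓡 n) (p j) (p j)) :=
    fun j ↦ geodesicFamily g (p j)
  let K : ℤ → unitInterval × ℝ → M := fun j z ↦ (extChartAt (𝓡 n) (p j)).symm
    (bvpCurve _ (q j z.1, (F j).accel (q j z.1)) (projIcc 0 1 zero_le_one (z.2 - j)))
  have hstart : ∀ (z : C(UnitAddCircle, M)) (j : ℤ), (F j).HasArc (toCurve z) (j / k) (1 / k) →
      chartCurve (p j) (toCurve z) (j / k) ∈ ball (extChartAt (𝓡 n) (p j) (p j)) (F j).r ∧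
      toCurve z (j / k) ∈ (extChartAt (𝓡 n) (p j)).source := by
    intro z j hz
    have h0 := hz 0
    rw [show (j : ℝ) / k + 1 / k * ((0 : unitInterval) : ℝ) = j / k by simp] at h0
    exact ⟨h0.2.1, h0.1⟩
  have hA : ∀ j s, A j s ∈ ball (extChartAt (𝓡 n) (p j) (p j)) (F j).radius := fun j s ↦
    ball_subset_ball (F j).r_lt.le ((convex_ball _ _).lineMap_mem (hstart y j (hy j)).1
      (hstart x j (hx j)).1 s.2)
  have hAt : ∀ j s, A j s ∈ (extChartAt (𝓡 n) (p j)).target :=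
    fun j s ↦ (F j).ball_subset_target (hA j s)
  have hq : ∀ j s, q j s ∈ ball (extChartAt (𝓡 n) (p j) (p j)) (F j).radius ×ˢ
      ball (extChartAt (𝓡 n) (p j) (p j)) (F j).radius := fun j s ↦ ⟨hA j s, (hxy j s s.2).2⟩
  have hAc : ∀ j, Continuous (A j) := fun j ↦
    AffineMap.lineMap_continuous.comp continuous_subtype_val
  have hmc : ∀ j, Continuous (m j) := fun j ↦
    (continuousOn_extChartAt_symm (p j)).comp_continuous (hAc j) (hAt j)
  have hqc : ∀ j, Continuous (q j) := fun j ↦ (hAc j).prodMk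
    ((continuousOn_extChartAt (p j)).comp_continuous (hmc (j + 1)) fun s ↦ (hxy j s s.2).1)
  have hKc : ∀ j, Continuous (K j) := by
    intro j
    have h1 : Continuous fun s ↦ bvpCurve _ (q j s, (F j).accel (q j s)) := by
      rw [continuous_iff_continuousAt]
      exact fun s ↦ ContinuousAt.comp (f := q j)
        (g := fun q ↦ bvpCurve _ (q, (F j).accel q)) ((F j).continuousAt_bvpJet (hq j s)).1
        (hqc j).continuousAt
    have h2 : Continuous fun z : unitInterval × ℝ ↦ bvpCurve _ (q j z.1, (F j).accel (q j z.1))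
        (projIcc 0 1 zero_le_one (z.2 - j)) :=
      (h1.comp continuous_fst).eval (continuous_projIcc.comp (continuous_snd.sub continuous_const))
    exact (continuousOn_extChartAt_symm (p j)).comp_continuous h2
      fun z ↦ (F j).mem_target _ (hq j z.1) _
  -- consecutive arcs have a common end point
  have hglue : ∀ j s, K j (s, (j : ℝ) + 1) = K (j + 1) (s, (j : ℝ) + 1) := by
    intro j s
    have e1 : projIcc (0 : ℝ) 1 zero_le_one ((j : ℝ) + 1 - j) = 1 := by
      rw [add_sub_cancel_left]; exact projIcc_right _
    have e0 : projIcc (0 : ℝ) 1 zero_le_one ((j : ℝ) + 1 - (j + 1 : ℤ)) = 0 := by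
      push_cast; rw [sub_self]; exact projIcc_left _
    simp only [K, e1, e0, bvpCurve_one, bvpCurve_zero]
    exact (extChartAt (𝓡 n) (p j)).left_inv (hxy j s s.2).1
  have hcont := (continuous_floor_glue hKc hglue).comp
    ((continuous_fst (X := unitInterval) (Y := ℝ)).prodMk (continuous_const.mul continuous_snd :
      Continuous fun z : unitInterval × ℝ ↦ (k : ℝ) * z.2))
  have hperz : ∀ (z : C(UnitAddCircle, M)) (j : ℤ),
      toCurve z ((j + k : ℤ) / k) = toCurve z (j / k) := by
    intro z j
    rw [← toCurve_add_one z (j / k)]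
    congr 1
    push_cast
    field_simp
  have hAper : ∀ j s, A (j + k) s = A j s := by
    intro j s
    simp only [A, hp, hperz]
  have hmper : ∀ j s, m (j + k) s = m j s := by
    intro j s
    simp only [m, hp, hAper]
  have hKper : ∀ (j : ℤ) s t, K (j + k) (s, t + k) = K j (s, t) := by
    intro j s t
    have h1 : q (j + k) s = q j s := by
      have h2 : m (j + k + 1) s = m (j + 1) s := by rw [add_right_comm, hmper]
      simp only [q, hp, hAper, h2]
    have h3 : ∀ p' : M, p' = p j → (extChartAt (𝓡 n) p').symm
        (bvpCurve _ (q (j + k) s, (geodesicFamily g p').accel (q (j + k) s))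
          (projIcc 0 1 zero_le_one (t + k - (j + k : ℤ)))) = K j (s, t) := by
      rintro p' rfl
      have h2 : t + k - ((j + k : ℤ) : ℝ) = t - j := by push_cast; ring
      simp only [h1, K, F, h2]
    exact h3 _ (hp j)
  -- at the two ends of the homotopy the arcs are those of the two geodesics
  have hend : ∀ (z : C(UnitAddCircle, M)) (s : unitInterval),
      (∀ j : ℤ, (F j).HasArc (toCurve z) (j / k) (1 / k)) →
      (∀ j : ℤ, A j s = chartCurve (p j) (toCurve z) (j / k)) →
      ∀ t : ℝ, K ⌊(k : ℝ) * t⌋ (s, k * t) = toCurve z t := by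
    intro z s hz hAz t
    set j := ⌊(k : ℝ) * t⌋ with hj
    have hI : (k : ℝ) * t - j ∈ Icc (0 : ℝ) 1 :=
      ⟨Int.fract_nonneg ((k : ℝ) * t), (Int.fract_lt_one ((k : ℝ) * t)).le⟩
    obtain ⟨h1, -, h3, -⟩ := hz j ⟨_, hI⟩
    have e1 : (j : ℝ) / k + 1 / k * (k * t - j) = t := by field_simp; ring
    have e2 : (j : ℝ) / k + 1 / k = (j + 1 : ℤ) / k := by push_cast; ring
    have hm1 : m (j + 1) s = toCurve z ((j + 1 : ℤ) / k) := by
      simp only [m, hAz]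
      exact (extChartAt (𝓡 n) (p (j + 1))).left_inv (hstart z (j + 1) (hz (j + 1))).2
    have hq1 : q j s = (chartCurve (p j) (toCurve z) (j / k),
        chartCurve (p j) (toCurve z) (j / k + 1 / k)) := by
      simp only [q, hm1, hAz, e2]; rfl
    simp only [e1] at h1 h3
    simp only [K, hq1]
    rw [projIcc_of_mem _ hI, h3]
    exact (extChartAt (𝓡 n) (p j)).left_inv h1
  refine homotopic_of_periodic hcont ?_ ?_ ?_
  · intro s t
    change K ⌊(k : ℝ) * (t + 1)⌋ (s, k * (t + 1)) = K ⌊(k : ℝ) * t⌋ (s, k * t)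
    rw [mul_add, mul_one, Int.floor_add_natCast]
    exact hKper _ s _
  · refine hend y 0 hy fun j ↦ ?_
    simp [A, chartSegment, chartCurve]
  · refine hend x 1 hx fun j ↦ ?_
    simp [A, chartSegment, chartCurve]

/-- If periodic geodesics of bounded length converge pointwise to a periodic geodesic along a
filter, then they are eventually homotopic to the limit. -/
theorem eventually_freeHomotopyClass_eq [T2Space M] [CompactSpace M] {g : RiemannianMetric n M}
    {ι : Type*} {l : Filter ι} {x : ι → C(UnitAddCircle, M)} {y : C(UnitAddCircle, M)} {L : ℝ}
    (hL : 0 ≤ L) (hx : ∀ᶠ i in l, IsPeriodicGeodesic g (x i) ∧ loopLength g (x i) ≤ L)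
    (hy : IsPeriodicGeodesic g y) (hyL : loopLength g y ≤ L)
    (hlim : ∀ t, Tendsto (fun i ↦ toCurve (x i) t) l (𝓝 (toCurve y t))) :
    ∀ᶠ i in l, freeHomotopyClass (x i) = freeHomotopyClass y := by
  obtain ⟨P, W, c, k, hk, hW, hc, H⟩ := exists_uniform_arcs g hL
  have hk' : (k : ℝ) ≠ 0 := by exact_mod_cast hk.ne'
  have hperz : ∀ (z : C(UnitAddCircle, M)) (j : ℤ),
      toCurve z ((j + k : ℤ) / k) = toCurve z (j / k) := by
    intro z j
    rw [← toCurve_add_one z (j / k)]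
    congr 1
    push_cast
    field_simp
  let p : ℤ → M := fun j ↦ c (toCurve y (j / k))
  have hp : ∀ j, p (j + k) = p j := fun j ↦ by simp only [p, hperz]
  have hyarc : ∀ j : ℤ, (geodesicFamily g (p j)).HasArc (toCurve y) (j / k) (1 / k) :=
    fun j ↦ H y hy hyL _ (hc _).1 _ (hc _).2
  let V : M → Set M := fun p ↦ (extChartAt (𝓡 n) p).source ∩ extChartAt (𝓡 n) p ⁻¹'
    ball (extChartAt (𝓡 n) p p) (geodesicFamily g p).radius
  have hV : ∀ p, IsOpen (V p) := fun p ↦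
    (continuousOn_extChartAt p).isOpen_inter_preimage (isOpen_extChartAt_source p) isOpen_ball
  have hsrc : ∀ j : ℤ, toCurve y (j / k) ∈ (extChartAt (𝓡 n) (p j)).source := by
    intro j
    simpa using (hyarc j 0).1
  have hend : ∀ j : ℤ, toCurve y ((j + 1 : ℤ) / k) ∈ V (p j) := by
    intro j
    have h1 := hyarc j 1
    rw [show (j : ℝ) / k + 1 / k * ((1 : unitInterval) : ℝ) = (j + 1 : ℤ) / k by
      rw [Set.Icc.coe_one]; push_cast; ring] at h1
    exact ⟨h1.1, ball_subset_ball (geodesicFamily g (p j)).r_lt.le h1.2.1⟩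
  have hN : ∀ j : ℤ, ∃ N ∈ 𝓝 (toCurve y ((j + 1 : ℤ) / k)), ∀ m ∈ N, ∀ s ∈ Icc (0 : ℝ) 1,
      (extChartAt (𝓡 n) (p (j + 1))).symm (chartSegment (p (j + 1))
        (toCurve y ((j + 1 : ℤ) / k)) m s) ∈ V (p j) := fun j ↦
    exists_nhds_chartSegment_mem (hsrc (j + 1)) ((hV _).mem_nhds (hend j))
  choose N hN hNV using hN
  have hev : ∀ᶠ i in l, ∀ j ∈ Finset.range k, toCurve (x i) ((j : ℤ) / k) ∈ W (p j) ∧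
      toCurve (x i) (((j : ℤ) + 1 : ℤ) / k) ∈ N j := by
    rw [Finset.eventually_all]
    intro j _
    exact ((hlim _).eventually ((hW _).mem_nhds (hc _).2)).and ((hlim _).eventually (hN j))
  filter_upwards [hx, hev] with i hi hev
  refine (Quotient.sound (?_ : ContinuousMap.Homotopic y (x i))).symm
  let S : ℤ → Prop := fun j ↦ toCurve (x i) (j / k) ∈ W (p j) ∧ ∀ s ∈ Icc (0 : ℝ) 1,
      (extChartAt (𝓡 n) (p (j + 1))).symm (chartSegment (n := n) (p (j + 1))
        (toCurve y ((j + 1 : ℤ) / k)) (toCurve (x i) ((j + 1 : ℤ) / k)) s) ∈ V (p j)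
  have hSper : Function.Periodic S k := by
    intro j
    have h2 : j + (k : ℤ) + 1 = j + 1 + k := add_right_comm _ _ _
    simp only [S, h2, hp, hperz]
  have hS : ∀ j, S j := by
    intro j
    have h1 : S (j % k) := by
      have hk0 : (0 : ℤ) < k := by exact_mod_cast hk
      obtain ⟨m, hm⟩ := Int.eq_ofNat_of_zero_le (Int.emod_nonneg j hk0.ne')
      have hlt := Int.emod_lt_of_pos j hk0
      rw [hm] at hlt ⊢
      have h3 := hev m (Finset.mem_range.2 (by exact_mod_cast hlt))
      exact ⟨h3.1, hNV m _ h3.2⟩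
    have h2 : S j = S (j % k) := by
      rw [Int.emod_def, mul_comm]
      exact (hSper.sub_int_mul_eq (j / k)).symm
    rw [h2]; exact h1
  exact homotopic_of_hasArc hk hp (fun j ↦ H (x i) hi.1 hi.2 _ (hc _).1 _ (hS j).1) hyarc
    fun j ↦ (hS j).2

end Homotopy

/-! ### The marked length spectrum is closed -/

section Closed

variable {n : ℕ} {M : Type*} [TopologicalSpace M] [ChartedSpace (EuclideanSpace ℝ (Fin n)) M]
  [IsManifold (𝓡 n) ∞ M]

theorem loopLength_nonneg (g : RiemannianMetric n M) (x : C(UnitAddCircle, M)) :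
    0 ≤ loopLength g x :=
  intervalIntegral.integral_nonneg zero_le_one fun _ _ ↦ Real.sqrt_nonneg _

theorem isClosed_markedLengthSpectrum [T2Space M] [CompactSpace M] (g : RiemannianMetric n M)
    (α : FreeHomotopyClass M) : IsClosed (markedLengthSpectrum g α) := by
  rw [isClosed_iff_ultrafilter]
  intro ℓ 𝒰 h𝒰 hmem
  have hL : (0 : ℝ) ≤ |ℓ| + 1 := by positivity
  have hx : ∀ s : ℝ, ∃ x : C(UnitAddCircle, M), s ∈ markedLengthSpectrum g α →
      IsPeriodicGeodesic g x ∧ freeHomotopyClass x = α ∧ loopLength g x = s := by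
    intro s
    by_cases hs : s ∈ markedLengthSpectrum g α
    · exact ⟨hs.choose, fun _ ↦ hs.choose_spec⟩
    · exact ⟨α.exists_rep.choose, fun h ↦ absurd h hs⟩
  choose x hx using hx
  have hlt : ∀ᶠ s in (𝒰 : Filter ℝ), s < |ℓ| + 1 :=
    h𝒰 (gt_mem_nhds ((le_abs_self ℓ).trans_lt (lt_add_one _)))
  have hΛ : ∀ᶠ s in (𝒰 : Filter ℝ), s ∈ markedLengthSpectrum g α := hmem
  have hxL : ∀ᶠ s in (𝒰 : Filter ℝ), IsPeriodicGeodesic g (x s) ∧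
      loopLength g (x s) ≤ |ℓ| + 1 := by
    filter_upwards [hlt, hΛ] with s hs hs'
    obtain ⟨h1, -, h3⟩ := hx s hs'
    exact ⟨h1, h3.trans_le hs.le⟩
  obtain ⟨y, hy, hlim, hlen⟩ := exists_tendsto_isPeriodicGeodesic hL hxL
  have hyℓ : loopLength g y = ℓ := by
    refine tendsto_nhds_unique hlen (Tendsto.congr' ?_ (tendsto_id'.2 h𝒰))
    filter_upwards [hΛ] with s hs
    exact (hx s hs).2.2.symm
  have hyL : loopLength g y ≤ |ℓ| + 1 := by
    rw [hyℓ]; exact (le_abs_self ℓ).trans (lt_add_one _).le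
  obtain ⟨s, hs, hs'⟩ := ((eventually_freeHomotopyClass_eq hL hxL hy hyL hlim).and hΛ).exists
  exact ⟨y, hy, hs.symm.trans (hx s hs').2.1, hyℓ⟩

end Closed

/-! ### Lengths of periodic geodesics are critical values -/

section Critical

variable {n : ℕ} {M : Type*} [TopologicalSpace M] [ChartedSpace (EuclideanSpace ℝ (Fin n)) M]
  [IsManifold (𝓡 n) ∞ M]

/-- The coordinate change from the chart at `p'` to the chart at `p`. -/
noncomputable def chartChange (p' p : M) (y : EuclideanSpace ℝ (Fin n)) :
    EuclideanSpace ℝ (Fin n) :=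
  extChartAt (𝓡 n) p ((extChartAt (𝓡 n) p').symm y)

omit [IsManifold (𝓡 n) ∞ M] in
theorem chartChange_chartCurve {p' p : M} {γ : ℝ → M} {t : ℝ}
    (ht : γ t ∈ (extChartAt (𝓡 n) p').source) :
    chartChange p' p (chartCurve (n := n) p' γ t) = chartCurve p γ t :=
  congrArg _ ((extChartAt (𝓡 n) p').left_inv ht)

/-- The pairing of the velocity of a curve with a tangent vector does not depend on the chart in
which it is computed. -/
theorem chartMetric_deriv_chartCurve_chartChange (g : RiemannianMetric n M) {γ : ℝ → M}
    (hγ : ContMDiff 𝓘(ℝ, ℝ) (𝓡 n) ∞ γ) {p p' : M} {t : ℝ}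
    (ht : γ t ∈ (extChartAt (𝓡 n) p).source) (ht' : γ t ∈ (extChartAt (𝓡 n) p').source)
    (ζ : EuclideanSpace ℝ (Fin n)) :
    chartMetric g p (chartCurve p γ t) (deriv (chartCurve p γ) t)
        (fderiv ℝ (chartChange p' p) (chartCurve p' γ t) ζ) =
      chartMetric g p' (chartCurve p' γ t) (deriv (chartCurve p' γ) t) ζ := by
  have h2 : (extChartAt (𝓡 n) p).symm (chartCurve p γ t) = γ t := (extChartAt (𝓡 n) p).left_inv ht
  have h2' : (extChartAt (𝓡 n) p').symm (chartCurve p' γ t) = γ t :=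
    (extChartAt (𝓡 n) p').left_inv ht'
  have hy : chartCurve p' γ t ∈ (extChartAt (𝓡 n) p').target :=
    (extChartAt (𝓡 n) p').map_source ht'
  have h3 := chartFrame_fderiv (mdifferentiableAt_chart_symm hy) (p := p) (by rwa [h2']) ζ
  rw [h2'] at h3
  rw [chartMetric_apply, chartMetric_apply, chartFrame_deriv_chartCurve hγ ht,
    chartFrame_deriv_chartCurve hγ ht']
  have h4 : chartFrame p (chartCurve p γ t)
      (fderiv ℝ (chartChange p' p) (chartCurve p' γ t) ζ) = chartFrame p' (chartCurve p' γ t) ζ := h3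
  rw [h4, h2, h2']

variable (g : RiemannianMetric n M)

/-- The open set of those coordinates in the chart at `p'` which belong to the family of arcs at
`p'`, and to the one at `p` after the change of coordinates. -/
def arcOverlap (p' p : M) : Set (EuclideanSpace ℝ (Fin n)) :=
  ball (extChartAt (𝓡 n) p' p') (geodesicFamily g p').radius ∩ (extChartAt (𝓡 n) p').symm ⁻¹'
    ((extChartAt (𝓡 n) p).source ∩ extChartAt (𝓡 n) p ⁻¹'
      ball (extChartAt (𝓡 n) p p) (geodesicFamily g p).radius)

theorem isOpen_arcOverlap (p' p : M) : IsOpen (arcOverlap g p' p) :=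
  ((continuousOn_extChartAt_symm p').mono
    (geodesicFamily g p').ball_subset_target).isOpen_inter_preimage isOpen_ball
    ((continuousOn_extChartAt p).isOpen_inter_preimage (isOpen_extChartAt_source p) isOpen_ball)

theorem contDiffOn_chartChange (p' p : M) :
    ContDiffOn ℝ ∞ (chartChange p' p) (arcOverlap g p' p) := by
  refine (contDiffOn_ext_coord_change (I := 𝓡 n) (n := ∞) p p').mono ?_
  exact fun y hy ↦ ⟨(geodesicFamily g p').ball_subset_target hy.1, hy.2.1⟩

variable {k : ℕ} [NeZero k]

/-- The domain of `brokenEnergy g p`. -/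
def brokenDomain (p : Fin k → M) : Set (Fin k → EuclideanSpace ℝ (Fin n)) :=
  {z | ∀ j, z j ∈ ball (extChartAt (𝓡 n) (p j) (p j)) (geodesicFamily g (p j)).radius ∧
    z (j + 1) ∈ arcOverlap g (p (j + 1)) (p j)}

/-- The two end points of the arc number `j` of the closed broken geodesic with vertices `z`, both in
the chart at `p j`. The vertex `z j` is given in the chart at `p j`, and the indices are cyclic. -/
noncomputable def brokenEnds (p : Fin k → M) (j : Fin k) (z : Fin k → EuclideanSpace ℝ (Fin n)) :
    EuclideanSpace ℝ (Fin n) × EuclideanSpace ℝ (Fin n) :=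
  (z j, chartChange (p (j + 1)) (p j) (z (j + 1)))

/-- The energy of the closed broken geodesic with `k` vertices, as a function of the coordinates of
the vertices in the charts at the points `p j`. -/
noncomputable def brokenEnergy (p : Fin k → M) (z : Fin k → EuclideanSpace ℝ (Fin n)) : ℝ :=
  ∑ j, (geodesicFamily g (p j)).energy (brokenEnds p j z)

theorem isOpen_brokenDomain (p : Fin k → M) : IsOpen (brokenDomain g p) := by
  have h : brokenDomain g p = ⋂ j, (fun z ↦ z j) ⁻¹'
      ball (extChartAt (𝓡 n) (p j) (p j)) (geodesicFamily g (p j)).radius ∩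
      (fun z ↦ z (j + 1)) ⁻¹' arcOverlap g (p (j + 1)) (p j) := by
    ext z
    simp [brokenDomain]
  rw [h]
  exact isOpen_iInter_of_finite fun j ↦ (isOpen_ball.preimage (continuous_apply j)).inter
    ((isOpen_arcOverlap g (p (j + 1)) (p j)).preimage (continuous_apply (j + 1)))

variable {g}

theorem brokenEnds_mem {p : Fin k → M} {z : Fin k → EuclideanSpace ℝ (Fin n)}
    (hz : z ∈ brokenDomain g p) (j : Fin k) :
    brokenEnds p j z ∈ ball (extChartAt (𝓡 n) (p j) (p j)) (geodesicFamily g (p j)).radius ×ˢ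
      ball (extChartAt (𝓡 n) (p j) (p j)) (geodesicFamily g (p j)).radius :=
  ⟨(hz j).1, (hz j).2.2.2⟩

theorem contDiffOn_brokenEnds (p : Fin k → M) (j : Fin k) :
    ContDiffOn ℝ ∞ (brokenEnds p j) (brokenDomain g p) :=
  (contDiff_apply ℝ _ j).contDiffOn.prodMk
    ((contDiffOn_chartChange g (p (j + 1)) (p j)).comp
      (contDiff_apply ℝ (EuclideanSpace ℝ (Fin n)) (j + 1)).contDiffOn fun _ hz ↦ (hz j).2)

theorem contDiffOn_brokenEnergy (p : Fin k → M) :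
    ContDiffOn ℝ ∞ (brokenEnergy g p) (brokenDomain g p) :=
  ContDiffOn.sum fun j _ ↦ (geodesicFamily g (p j)).contDiffOn_energy.comp
    (contDiffOn_brokenEnds p j) fun _ hz ↦ brokenEnds_mem hz j

/-- The first variation formula for closed broken geodesics. -/
theorem fderiv_brokenEnergy {p : Fin k → M} {z : Fin k → EuclideanSpace ℝ (Fin n)}
    (hz : z ∈ brokenDomain g p) (ζ : Fin k → EuclideanSpace ℝ (Fin n)) :
    fderiv ℝ (brokenEnergy g p) z ζ = ∑ j, fderiv ℝ (geodesicFamily g (p j)).energy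
      (brokenEnds p j z) (ζ j, fderiv ℝ (chartChange (p (j + 1)) (p j)) (z (j + 1)) (ζ (j + 1))) := by
  have h1 : ∀ j, HasFDerivAt (fun z ↦ (geodesicFamily g (p j)).energy (brokenEnds p j z))
      ((fderiv ℝ (geodesicFamily g (p j)).energy (brokenEnds p j z)).comp
        ((ContinuousLinearMap.proj j).prod
          ((fderiv ℝ (chartChange (p (j + 1)) (p j)) (z (j + 1))).comp
            (ContinuousLinearMap.proj (j + 1))))) z := by
    intro j
    have hE := ((geodesicFamily g (p j)).contDiffOn_energy.contDiffAt
      ((isOpen_ball.prod isOpen_ball).mem_nhds (brokenEnds_mem hz j))).differentiableAt (by simp)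
    have hC := ((contDiffOn_chartChange g (p (j + 1)) (p j)).contDiffAt
      ((isOpen_arcOverlap g _ _).mem_nhds (hz j).2)).differentiableAt (by simp)
    have hQ : HasFDerivAt (brokenEnds p j) ((ContinuousLinearMap.proj j).prod
          ((fderiv ℝ (chartChange (p (j + 1)) (p j)) (z (j + 1))).comp
            (ContinuousLinearMap.proj (j + 1)))) z :=
      (hasFDerivAt_apply j z).prodMk
        (HasFDerivAt.comp z (f := fun z : Fin k → EuclideanSpace ℝ (Fin n) ↦ z (j + 1))
          hC.hasFDerivAt (hasFDerivAt_apply (j + 1) z))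
    exact hE.hasFDerivAt.comp z hQ
  have h2 : HasFDerivAt (brokenEnergy g p) _ z := HasFDerivAt.fun_sum fun j _ ↦ h1 j
  rw [h2.fderiv, sum_apply]
  rfl

/-- In the subdivision of the period into `k` parts, the end of each part is the beginning of the
next one, up to a period. -/
theorem _root_.Function.Periodic.map_fin_add_one_div {β : Type*} {f : ℝ → β}
    (hf : Function.Periodic f 1) (j : Fin k) :
    f (((j + 1 : Fin k) : ℕ) / k) = f ((j : ℕ) / k + 1 / k) := by
  have hk : (k : ℝ) ≠ 0 := by exact_mod_cast NeZero.ne k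
  have h1 : ((j + 1 : Fin k) : ℕ) = ((j : ℕ) + 1) % k := by
    rw [Fin.val_add, Fin.val_one', Nat.add_mod_mod]
  have h2 : ((j : ℕ) + 1 : ℝ) = ((((j : ℕ) + 1) % k : ℕ) : ℝ) + k * ((((j : ℕ) + 1) / k : ℕ) : ℝ) := by
    exact_mod_cast (Nat.mod_add_div ((j : ℕ) + 1) k).symm
  rw [h1, ← add_div, h2, add_div, mul_div_cancel_left₀ _ hk]
  rw [← mul_one ((((j : ℕ) + 1) / k : ℕ) : ℝ)]
  exact (hf.nat_mul (((j : ℕ) + 1) / k) (((((j : ℕ) + 1) % k : ℕ) : ℝ) / k)).symm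

/-- The vertices of a periodic geodesic composed of `k` short arcs are a critical point of the
energy of broken geodesics, and its critical value is a multiple of the square of the length. -/
theorem exists_fderiv_brokenEnergy_eq_zero {x : C(UnitAddCircle, M)}
    (hx : IsPeriodicGeodesic g x) {p : Fin k → M}
    (harc : ∀ j : Fin k, (geodesicFamily g (p j)).HasArc (toCurve x) ((j : ℕ) / k) (1 / k)) :
    ∃ z ∈ brokenDomain g p, fderiv ℝ (brokenEnergy g p) z = 0 ∧
      brokenEnergy g p z = loopLength g x ^ 2 / (2 * k) := by
  have hk : (k : ℝ) ≠ 0 := by exact_mod_cast NeZero.ne k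
  let γ := toCurve x
  have hγ : Function.Periodic γ 1 := fun t ↦ toCurve_add_one x t
  have hcc : ∀ p : M, Function.Periodic (chartCurve (n := n) p γ) 1 := fun p t ↦
    congrArg (extChartAt (𝓡 n) p) (hγ t)
  have hdcc : ∀ p : M, Function.Periodic (deriv (chartCurve (n := n) p γ)) 1 := by
    intro p t
    have h1 : (fun s ↦ chartCurve (n := n) p γ (s + 1)) = chartCurve p γ := funext (hcc p)
    rw [← deriv_comp_add_const, h1]
  have hstart : ∀ j : Fin k, γ ((j : ℕ) / k) ∈ (extChartAt (𝓡 n) (p j)).source ∧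
      chartCurve (p j) γ ((j : ℕ) / k) ∈
        ball (extChartAt (𝓡 n) (p j) (p j)) (geodesicFamily g (p j)).radius := by
    intro j
    obtain ⟨h1, h2, -⟩ := harc j 0
    rw [show ((j : ℕ) : ℝ) / k + 1 / k * ((0 : unitInterval) : ℝ) = (j : ℕ) / k by simp] at h1 h2
    exact ⟨h1, ball_subset_ball (geodesicFamily g (p j)).r_lt.le h2⟩
  have hend : ∀ j : Fin k, γ (((j + 1 : Fin k) : ℕ) / k) ∈ (extChartAt (𝓡 n) (p j)).source ∧
      chartCurve (p j) γ (((j + 1 : Fin k) : ℕ) / k) ∈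
        ball (extChartAt (𝓡 n) (p j) (p j)) (geodesicFamily g (p j)).radius := by
    intro j
    obtain ⟨h1, h2, -⟩ := harc j 1
    rw [show ((j : ℕ) : ℝ) / k + 1 / k * ((1 : unitInterval) : ℝ) = (j : ℕ) / k + 1 / k by
      rw [Set.Icc.coe_one, mul_one]] at h1 h2
    rw [hγ.map_fin_add_one_div, (hcc (p j)).map_fin_add_one_div]
    exact ⟨h1, ball_subset_ball (geodesicFamily g (p j)).r_lt.le h2⟩
  let z : Fin k → EuclideanSpace ℝ (Fin n) := fun j ↦ chartCurve (p j) γ ((j : ℕ) / k)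
  have hzz : ∀ j, (extChartAt (𝓡 n) (p j)).symm (z j) = γ ((j : ℕ) / k) :=
    fun j ↦ (extChartAt (𝓡 n) (p j)).left_inv (hstart j).1
  have hz : z ∈ brokenDomain g p := by
    intro j
    refine ⟨(hstart j).2, (hstart (j + 1)).2, ?_⟩
    rw [mem_preimage, hzz]
    exact hend j
  have hends : ∀ j, brokenEnds p j z =
      (chartCurve (p j) γ ((j : ℕ) / k), chartCurve (p j) γ ((j : ℕ) / k + 1 / k)) := by
    intro j
    rw [brokenEnds, ← (hcc (p j)).map_fin_add_one_div]
    exact congrArg _ (chartChange_chartCurve (hstart (j + 1)).1)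
  refine ⟨z, hz, ?_, ?_⟩
  · ext ζ
    rw [fderiv_brokenEnergy hz, zero_apply]
    -- `β j` is the boundary term at the vertex `j`, which occurs once for each adjacent arc
    let β : Fin k → ℝ := fun j ↦ chartMetric g (p j) (z j)
      ((1 / k : ℝ) • deriv (chartCurve (p j) γ) ((j : ℕ) / k)) (ζ j)
    have hβ : ∀ j, fderiv ℝ (geodesicFamily g (p j)).energy (brokenEnds p j z)
        (ζ j, fderiv ℝ (chartChange (p (j + 1)) (p j)) (z (j + 1)) (ζ (j + 1))) =
        β (j + 1) - β j := by
      intro j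
      have h0 := (harc j 0).2.2.2
      have h1 := (harc j 1).2.2.2
      rw [show ((j : ℕ) : ℝ) / k + 1 / k * ((0 : unitInterval) : ℝ) = (j : ℕ) / k by simp] at h0
      rw [show ((j : ℕ) : ℝ) / k + 1 / k * ((1 : unitInterval) : ℝ) = (j : ℕ) / k + 1 / k by
        rw [Set.Icc.coe_one, mul_one]] at h1
      rw [(geodesicFamily g (p j)).fderiv_energy _ (brokenEnds_mem hz j), hends j]
      simp only [γ] at h0 h1 ⊢
      rw [h0, h1]
      have h2 := chartMetric_deriv_chartCurve_chartChange g hx.1 (hend j).1 (hstart (j + 1)).1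
        (ζ (j + 1))
      rw [(hcc (p j)).map_fin_add_one_div, (hdcc (p j)).map_fin_add_one_div] at h2
      simp only [β, map_smul, smul_apply]
      congr 2
    rw [Finset.sum_congr rfl fun j _ ↦ hβ j, Finset.sum_sub_distrib]
    exact sub_eq_zero.2 (Equiv.sum_comp (Equiv.addRight (1 : Fin k)) β)
  · have hE : ∀ j, (geodesicFamily g (p j)).energy (brokenEnds p j z) =
        loopLength g x ^ 2 / k ^ 2 / 2 := by
      intro j
      refine (geodesicFamily g (p j)).energy_eq _ (brokenEnds_mem hz j) _ fun t ↦ ?_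
      obtain ⟨h1, -, h3, h4⟩ := harc j t
      rw [hends j]
      simp only [γ]
      rw [h3, h4, map_smul, map_smul, smul_apply, chartMetric_deriv_chartCurve g hx.1 h1,
        hx.speedSq_eq_loopLength_sq]
      simp only [smul_eq_mul]
      field_simp
    rw [brokenEnergy, Finset.sum_congr rfl fun j _ ↦ hE j]
    simp only [Finset.sum_const, Finset.card_univ, Fintype.card_fin, nsmul_eq_mul]
    field_simp

end Critical

/-! ### The marked length spectrum is nowhere dense -/

section NowhereDense

variable {n : ℕ} {M : Type*} [TopologicalSpace M] [ChartedSpace (EuclideanSpace ℝ (Fin n)) M]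
  [IsManifold (𝓡 n) ∞ M]

/-- The squares of the lengths of the periodic geodesics of length at most `L`, up to a factor, form
a set of Hausdorff dimension zero. -/
theorem exists_dimH_image_sq_div_eq_zero [T2Space M] [CompactSpace M] (g : RiemannianMetric n M)
    {L : ℝ} (hL : 0 ≤ L) : ∃ k : ℕ, 0 < k ∧ dimH ((fun ℓ : ℝ ↦ ℓ ^ 2 / (2 * k)) ''
      {ℓ | ℓ ≤ L ∧ ∃ x : C(UnitAddCircle, M), IsPeriodicGeodesic g x ∧ loopLength g x = ℓ}) = 0 := by
  obtain ⟨P, W, c, k, hk, -, hc, H⟩ := exists_uniform_arcs g hL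
  have : NeZero k := ⟨hk.ne'⟩
  refine ⟨k, hk, le_antisymm (le_trans (dimH_mono (t := ⋃ p : Fin k → P,
    brokenEnergy g (fun j ↦ (p j : M)) '' {z ∈ brokenDomain g (fun j ↦ (p j : M)) |
      fderiv ℝ (brokenEnergy g (fun j ↦ (p j : M))) z = 0}) ?_) ?_) zero_le⟩
  · rintro _ ⟨ℓ, ⟨hℓ, x, hx, rfl⟩, rfl⟩
    obtain ⟨z, hz, hz0, hzE⟩ := exists_fderiv_brokenEnergy_eq_zero hx
      (p := fun j : Fin k ↦ c (toCurve x ((j : ℕ) / k)))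
      fun j ↦ H x hx hℓ _ (hc _).1 _ (hc _).2
    exact mem_iUnion.2 ⟨fun j ↦ ⟨c (toCurve x ((j : ℕ) / k)), (hc _).1⟩, z, ⟨hz, hz0⟩, hzE⟩
  · rw [dimH_iUnion]
    exact iSup_le fun p ↦ (dimH_image_eq_zero_of_fderiv_eq_zero (isOpen_brokenDomain g _)
      (contDiffOn_brokenEnergy _) (fun z hz ↦ hz.1) fun z hz ↦ hz.2).le

theorem interior_markedLengthSpectrum [T2Space M] [CompactSpace M] (g : RiemannianMetric n M)
    (α : FreeHomotopyClass M) : interior (markedLengthSpectrum g α) = ∅ := by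
  by_contra h
  obtain ⟨L, hL⟩ := nonempty_iff_ne_empty.2 h
  obtain ⟨x₀, -, -, rfl⟩ := interior_subset hL
  have hL0 := loopLength_nonneg g x₀
  obtain ⟨k, hk, hdim⟩ := exists_dimH_image_sq_div_eq_zero g hL0
  obtain ⟨ε, hε, hball⟩ := Metric.mem_nhds_iff.1 (mem_interior_iff_mem_nhds.1 hL)
  set L := loopLength g x₀
  have hk' : (0 : ℝ) < k := by exact_mod_cast hk
  have hsub : Icc (L - ε / 2) L ⊆ markedLengthSpectrum g α := by
    intro ℓ hℓ
    refine hball ?_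
    rw [mem_ball, Real.dist_eq, abs_lt]
    constructor <;> linarith [hℓ.1, hℓ.2]
  have hpos : 0 ≤ L - ε / 2 := by
    obtain ⟨x, -, -, hx⟩ := hsub ⟨le_rfl, by linarith⟩
    rw [← hx]; exact loopLength_nonneg g x
  -- the critical values would fill an interval
  have hIcc : Icc ((L - ε / 2) ^ 2 / (2 * k)) (L ^ 2 / (2 * k)) ⊆ (fun ℓ : ℝ ↦ ℓ ^ 2 / (2 * k)) ''
      {ℓ | ℓ ≤ L ∧ ∃ x : C(UnitAddCircle, M), IsPeriodicGeodesic g x ∧ loopLength g x = ℓ} := by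
    refine (intermediate_value_Icc (f := fun ℓ : ℝ ↦ ℓ ^ 2 / (2 * k))
      (by linarith : L - ε / 2 ≤ L) (by fun_prop)).trans (image_mono ?_)
    intro ℓ hℓ
    obtain ⟨x, hx, -, hxℓ⟩ := hsub hℓ
    exact ⟨hℓ.2, x, hx, hxℓ⟩
  have hlt : (L - ε / 2) ^ 2 / (2 * k) < L ^ 2 / (2 * k) := by
    gcongr
    linarith
  have h1 := Real.dimH_of_nonempty_interior (E := ℝ) (s := Icc ((L - ε / 2) ^ 2 / (2 * k))
    (L ^ 2 / (2 * k))) (by rw [interior_Icc]; exact nonempty_Ioo.2 hlt)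
  have h2 := dimH_mono hIcc
  rw [h1, hdim] at h2
  simp at h2

end NowhereDense
end MarkedLength

theorem mainTheorem9 (n : ℕ) (M : Type*) [TopologicalSpace M] [T2Space M] [CompactSpace M]
    [ChartedSpace (EuclideanSpace ℝ (Fin n)) M] [IsManifold (𝓡 n) ∞ M]
    (g : Bundle.ContMDiffRiemannianMetric (𝓡 n) ∞ (EuclideanSpace ℝ (Fin n))
      (fun x : M ↦ TangentSpace (𝓡 n) x))
    (α : MarkedLength.FreeHomotopyClass M) :
    (IsClosed (MarkedLength.markedLengthSpectrum g α) ∧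
      IsNowhereDense (MarkedLength.markedLengthSpectrum g α)) ∧
    (IsOpen (MarkedLength.markedLengthSpectrum g α)ᶜ ∧
      Dense (MarkedLength.markedLengthSpectrum g α)ᶜ) := by
  have hc := MarkedLength.isClosed_markedLengthSpectrum g α
  have hi := MarkedLength.interior_markedLengthSpectrum g α
  exact ⟨⟨hc, hc.isNowhereDense_iff.2 hi⟩, hc.isOpen_compl, interior_eq_empty_iff_dense_compl.1 hi⟩
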